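/- **Setting.** Let $\mathbf C^\perp=(\mathbf C,\perp)$ be an orthogonal category (a small category with a class $\perp$ of cospans $U_1\to V\leftarrow U_2$ closed under transposition and under pre- and post-composition), with $\mathbf C$ filtered, and let a discrete group $G$ act on it strictly by orthogonal functors $\alpha_g$ ($\alpha_e=\mathrm{id}$, $\alpha_{g'}\alpha_g=\alpha_{g'g}$). Let $\mathfrak A$ be an AQFT over $\mathbf C^\perp$, i.e. a $\perp$-commutative functor from $\mathbf C$ to unital $C^\ast$-algebras, with a $G$-equivariance structure, i.e. natural $\ast$-isomorphisms $\Psi_g:\mathfrak A(U)\cong\mathfrak A(\alpha_g(U))$ with $\Psi_e=\mathrm{id}$ and $\Psi_{g'g}=\Psi_{g'}\Psi_g$. Let $\pi_0$ be a representation of $\mathfrak A$ on a complex Hilbert space $H_0$, i.e. a unital $\ast$-homomorphism $\operatorname{colim}\mathfrak A\to \mathrm B(H_0)$, equivalently a family of representations $\pi_{0U}:\mathfrak A(U)\to\mathrm B(H_0)$ compatible with the maps $\mathfrak A(f)$. Assume: 1. for every $U\in\mathbf C$ there is an orthogonal cospan $(U'\to V)\perp(U\to V)$; all $\pi_{0U}$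 are faithful; and Haag duality holds: $\pi_{0U}(\mathfrak A(U))''=\bigcap\pi_{0U'}(\mathfrak A(U'))'$ for every $U$, the intersection being over all orthogonal cospans $(U'\to V)\perp(U\to V)$; 2. for every $(U_1\to\widetilde U)\perp(U_2\to\widetilde U)$ there are a morphism $\widetilde U\to W$ and orthogonal cospans $(V_1\to W)\perp(V_2\to W)$, $(U_1'\to V_1)\perp(U_1\to V_1)$, $(U_2\to V_2)\perp(U_2'\to V_2)$ such that $(U_i'\to V_i\to W)\perp(\widetilde U\to W)$ for $i=1,2$; 3. $u:G\to\mathrm{PU}(H_0)$ is a projective unitary representation with $\pi_{0\alpha_g(U)}\circ(\Psi_g)_U=\mathrm{Ad}_{u_g}\circ\pi_{0U}$ for all $g\in G$ and $U\in\mathbf C$. Write $\mathfrak M(U)=\pi_{0U}(\mathfrak A(U))''$ and let $\mathfrak M_\star\subseteq \mathrm B(H_0)$ be the norm closure of $\bigcup_U\mathfrak M(U)$. Let $\mathbf{SSS}(U)$ be the $C^\ast$-category whose objects are the unital $\ast$-endomorphisms $\rho$ of $\mathfrak M_\star$ such that (i) for each $W\in\mathbf C$ there is a unitary $v$ on $H_0$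 with $v\,\rho(a)=a\,v$ for all $a\in\mathfrak M(W')$ and all $(W'\to V)\perp(W\to V)$, and (ii) $\rho(a)=a$ for all $a\in\mathfrak M(U')$ and all $(U'\to V)\perp(U\to V)$; morphisms $\rho\to\rho'$ are the $T\in\mathfrak M(U)$ with $T\rho(a)=\rho'(a)T$ for all $a\in\mathfrak M_\star$. Let $\mathbf{SSS}^{\mathrm{cov}}(U)\subseteq\mathbf{SSS}(U)$ be the full subcategory of covariant sectors, i.e. those $\rho$ for which there is a projective unitary representation $u^\rho:G\to\mathrm{PU}(H_0)$ with $\rho\,\mathrm{Ad}_{u_g}=\mathrm{Ad}_{u^\rho_g}\,\rho$ for all $g\in G$. **Theorem.** The following data form a $G$-equivariant locally constant prefactorization algebra over $\mathbf C^\perp$ on the categories $\mathbf{SSS}(U)$, with values in strict monoidal $C^\ast$-categories (with the maximal tensor product): * the strict monoidal structures with unit $\mathrm{id}$, $\rho\diamond\sigma=\rho\sigma$, and $T\diamond S=T\rho(S)$ for $T:\rho\to\rho'$, $S:\sigma\to\sigma'$; * the factorization products $\bigotimes_i\mathbf{SSS}(U_i)\to\mathbf{SSS}(V)$ assigned to tuples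 of pairwise orthogonal morphisms $f_i:U_i\to V$, $1\le i\le n$, given by the inclusions $\mathbf{SSS}(U_i)\subseteq\mathbf{SSS}(V)$ followed by the $n$-fold product $\diamond^n$ (the unit for $n=0$); * the functors $g\triangleright(-):\mathbf{SSS}(U)\to\mathbf{SSS}(\alpha_g(U))$, $g\triangleright\rho=\mathrm{Ad}_{u_g}\rho\,\mathrm{Ad}_{u_g^\ast}$, $g\triangleright T=\mathrm{Ad}_{u_g}(T)$. This structure restricts to the full subcategories $\mathbf{SSS}^{\mathrm{cov}}(U)$, and the restriction is again a $G$-equivariant locally constant prefactorization algebra with values in strict monoidal $C^\ast$-categories. Here locally constant means that every morphism $f:U\to\widetilde U$ of $\mathbf C$ is sent to a unitary equivalence: a fully faithful $\ast$-functor such that each object of the target is unitarily isomorphic to an object of its image. -/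

import Mathlib

open CategoryTheory

universe v u w w' v₁ u₁ v₂ u₂

namespace Superselection

noncomputable section

/-! ## Orthogonal categories, prefactorization operads, group actions -/

/-- An orthogonality relation on a category `C`: a class of cospans `U₁ ⟶ V ⟵ U₂`, closed under
transposition and under pre- and post-composition. -/
structure Orthogonality (C : Type u) [Category.{v} C] where
  perp : ∀ {U₁ U₂ V : C}, (U₁ ⟶ V) → (U₂ ⟶ V) → Prop
  symm : ∀ {U₁ U₂ V : C} {f₁ : U₁ ⟶ V} {f₂ : U₂ ⟶ V}, perp f₁ f₂ → perp f₂ f₁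
  postcomp : ∀ {U₁ U₂ V W : C} {f₁ : U₁ ⟶ V} {f₂ : U₂ ⟶ V} (h : V ⟶ W),
    perp f₁ f₂ → perp (f₁ ≫ h) (f₂ ≫ h)
  precomp : ∀ {U₁ U₂ V W₁ W₂ : C} {f₁ : U₁ ⟶ V} {f₂ : U₂ ⟶ V} (k₁ : W₁ ⟶ U₁) (k₂ : W₂ ⟶ U₂),
    perp f₁ f₂ → perp (k₁ ≫ f₁) (k₂ ≫ f₂)

namespace Orthogonality

variable {C : Type u} [Category.{v} C] (P : Orthogonality C)

/-- Operations `(U₁, …, Uₙ) → V` of the prefactorization operad: tuples of morphisms `Uᵢ ⟶ V` that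
are pairwise orthogonal. For `n = 0` there is exactly one operation. -/
def Op {n : ℕ} (U : Fin n → C) (V : C) : Type v :=
  {f : ∀ i, U i ⟶ V // ∀ i j, i ≠ j → P.perp (f i) (f j)}

variable {P}

/-- The `1`-ary operation given by a morphism; `unary (𝟙 V)` is the operadic identity. -/
def unary {U V : C} (f : U ⟶ V) : P.Op (fun _ : Fin 1 => U) V :=
  ⟨fun _ => f, fun i j h => (h (Subsingleton.elim i j)).elim⟩

/-- Operadic composition. The composite is indexed by the concatenation of tuples, i.e. by
`Fin (∑ i, k i)`, identified with the pairs `(i, l)` in lexicographic order. -/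
def Op.comp {n : ℕ} {U : Fin n → C} {V : C} (f : P.Op U V) {k : Fin n → ℕ}
    {W : ∀ i, Fin (k i) → C} (g : ∀ i, P.Op (W i) (U i)) :
    P.Op (fun j : Fin (∑ i, k i) => W (finSigmaFinEquiv.symm j).1 (finSigmaFinEquiv.symm j).2) V :=
  ⟨fun j => (g (finSigmaFinEquiv.symm j).1).1 (finSigmaFinEquiv.symm j).2 ≫
      f.1 (finSigmaFinEquiv.symm j).1, by
    have key : ∀ p q : (i : Fin n) × Fin (k i), p ≠ q →
        P.perp ((g p.1).1 p.2 ≫ f.1 p.1) ((g q.1).1 q.2 ≫ f.1 q.1) := by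
      rintro ⟨i, l⟩ ⟨i', l'⟩ h
      by_cases hi : i = i'
      · subst hi
        exact P.postcomp _ ((g i).2 l l' fun hl => h (by rw [hl]))
      · exact P.precomp _ _ (f.2 i i' hi)
    intro a b hab
    exact key _ _ fun h => hab (finSigmaFinEquiv.symm.injective h)⟩

/-- The permutation action on operations. -/
def Op.perm {n : ℕ} {U : Fin n → C} {V : C} (f : P.Op U V) (σ : Equiv.Perm (Fin n)) :
    P.Op (fun i => U (σ i)) V :=
  ⟨fun i => f.1 (σ i), fun _ _ h => f.2 _ _ fun e => h (σ.injective e)⟩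

variable (P)

/-- A (strict) action of a discrete group `G` on an orthogonal category by orthogonal functors. -/
structure GroupAction (G : Type*) [Group G] where
  functor : G → C ⥤ C
  map_perp : ∀ (g : G) {U₁ U₂ V : C} {f₁ : U₁ ⟶ V} {f₂ : U₂ ⟶ V},
    P.perp f₁ f₂ → P.perp ((functor g).map f₁) ((functor g).map f₂)
  functor_one : functor 1 = 𝟭 C
  functor_mul : ∀ g' g : G, functor (g' * g) = functor g ⋙ functor g'

variable {P}

namespace GroupAction

variable {G : Type*} [Group G] (α : P.GroupAction G)

/-- The object `α_g(U)`. -/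
abbrev obj (g : G) (U : C) : C := (α.functor g).obj U

theorem obj_one (U : C) : α.obj 1 U = U := by
  simp [obj, α.functor_one]

theorem obj_mul (g' g : G) (U : C) : α.obj (g' * g) U = α.obj g' (α.obj g U) := by
  simp [obj, α.functor_mul]

/-- The action of `α_g` on operations of the prefactorization operad. -/
def mapOp (g : G) {n : ℕ} {U : Fin n → C} {V : C} (f : P.Op U V) :
    P.Op (fun i => α.obj g (U i)) (α.obj g V) :=
  ⟨fun i => (α.functor g).map (f.1 i), fun i j h => α.map_perp g (f.2 i j h)⟩

end GroupAction

variable (P)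

/-- Every object is one leg of some orthogonal cospan. -/
def HasOrthogonalComplements : Prop :=
  ∀ U : C, ∃ (U' V : C) (f' : U' ⟶ V) (f : U ⟶ V), P.perp f' f

/-- The geometric separation property: for every orthogonal cospan
`(f₁ : U₁ ⟶ Ũ) ⊥ (f₂ : U₂ ⟶ Ũ)` there are a morphism `h : Ũ ⟶ W` and orthogonal cospans
`(V₁ ⟶ W) ⊥ (V₂ ⟶ W)`, `(U₁' ⟶ V₁) ⊥ (U₁ ⟶ V₁)` and `(U₂ ⟶ V₂) ⊥ (U₂' ⟶ V₂)` with
`(U₁' ⟶ V₁ ⟶ W) ⊥ (Ũ ⟶ W)` and `(U₂' ⟶ V₂ ⟶ W) ⊥ (Ũ ⟶ W)`. -/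
def HasSeparation : Prop :=
  ∀ {U₁ U₂ Ut : C} (f₁ : U₁ ⟶ Ut) (f₂ : U₂ ⟶ Ut), P.perp f₁ f₂ →
    ∃ (W V₁ V₂ U₁' U₂' : C) (h : Ut ⟶ W) (a₁ : V₁ ⟶ W) (a₂ : V₂ ⟶ W)
      (b₁' : U₁' ⟶ V₁) (b₁ : U₁ ⟶ V₁) (b₂ : U₂ ⟶ V₂) (b₂' : U₂' ⟶ V₂),
      P.perp a₁ a₂ ∧ P.perp b₁' b₁ ∧ P.perp b₂ b₂' ∧
      P.perp (b₁' ≫ a₁) h ∧ P.perp (b₂' ≫ a₂) h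

end Orthogonality

/-! ## C*-categories, strict monoidal C*-categories and their multi-morphisms -/

/-- A (unital) C*-category. In the diagrammatic order of composition, `T ≫ adj T` is the
endomorphism `T* ∘ T`. -/
class CStarCategory (𝒟 : Type u₁) extends Category.{v₁} 𝒟 where
  [homNormedAddCommGroup : ∀ X Y : 𝒟, NormedAddCommGroup (X ⟶ Y)]
  [homNormedSpace : ∀ X Y : 𝒟, NormedSpace ℂ (X ⟶ Y)]
  [homComplete : ∀ X Y : 𝒟, CompleteSpace (X ⟶ Y)]
  add_comp : ∀ {X Y Z : 𝒟} (S T : X ⟶ Y) (R : Y ⟶ Z), (S + T) ≫ R = S ≫ R + T ≫ R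
  comp_add : ∀ {X Y Z : 𝒟} (R : X ⟶ Y) (S T : Y ⟶ Z), R ≫ (S + T) = R ≫ S + R ≫ T
  smul_comp : ∀ {X Y Z : 𝒟} (c : ℂ) (S : X ⟶ Y) (R : Y ⟶ Z), (c • S) ≫ R = c • (S ≫ R)
  comp_smul : ∀ {X Y Z : 𝒟} (c : ℂ) (R : X ⟶ Y) (S : Y ⟶ Z), R ≫ (c • S) = c • (R ≫ S)
  /-- The involution `T ↦ T*`. -/
  adj : ∀ {X Y : 𝒟}, (X ⟶ Y) → (Y ⟶ X)
  adj_adj : ∀ {X Y : 𝒟} (T : X ⟶ Y), adj (adj T) = T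
  adj_id : ∀ X : 𝒟, adj (𝟙 X) = 𝟙 X
  adj_comp : ∀ {X Y Z : 𝒟} (T : X ⟶ Y) (S : Y ⟶ Z), adj (T ≫ S) = adj S ≫ adj T
  adj_add : ∀ {X Y : 𝒟} (S T : X ⟶ Y), adj (S + T) = adj S + adj T
  adj_smul : ∀ {X Y : 𝒟} (c : ℂ) (T : X ⟶ Y), adj (c • T) = star c • adj T
  norm_comp_le : ∀ {X Y Z : 𝒟} (T : X ⟶ Y) (S : Y ⟶ Z), ‖T ≫ S‖ ≤ ‖S‖ * ‖T‖
  /-- The C*-identity `‖T* T‖ = ‖T‖²`. -/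
  norm_comp_adj : ∀ {X Y : 𝒟} (T : X ⟶ Y), ‖T ≫ adj T‖ = ‖T‖ ^ 2
  /-- `T* T` is a positive element of the C*-algebra of endomorphisms of the source. -/
  comp_adj_pos : ∀ {X Y : 𝒟} (T : X ⟶ Y), ∃ S : X ⟶ X, T ≫ adj T = S ≫ adj S

attribute [reducible, instance] CStarCategory.homNormedAddCommGroup CStarCategory.homNormedSpace
attribute [instance] CStarCategory.homComplete

open CStarCategory

/-- A morphism of a C*-category is unitary if `T* T = 1` and `T T* = 1`. -/
def IsUnitaryHom {𝒟 : Type u₁} [CStarCategory.{v₁} 𝒟] {X Y : 𝒟} (T : X ⟶ Y) : Prop :=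
  T ≫ adj T = 𝟙 X ∧ adj T ≫ T = 𝟙 Y

/-- A `*`-functor between C*-categories. (Such functors are automatically norm-decreasing.) -/
structure StarFunctor (𝒟 : Type u₁) [CStarCategory.{v₁} 𝒟] (ℰ : Type u₂) [CStarCategory.{v₂} ℰ]
    extends 𝒟 ⥤ ℰ where
  map_add : ∀ {X Y : 𝒟} (S T : X ⟶ Y), map (S + T) = map S + map T
  map_smul : ∀ {X Y : 𝒟} (c : ℂ) (T : X ⟶ Y), map (c • T) = c • map T
  map_adj : ∀ {X Y : 𝒟} (T : X ⟶ Y), map (adj T) = adj (map T)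

/-- A `*`-functor of `n` variables: functorial, compatible with the involutions and linear in each
variable. By the universal property of the maximal tensor product, this is the same as a
`*`-functor `𝒟₁ ⊗ ⋯ ⊗ 𝒟ₙ → ℰ` of C*-categories; for `n = 0` it is the choice of an object of `ℰ`,
i.e. a `*`-functor out of the tensor unit. -/
structure MultiStarFunctor {n : ℕ} (𝒟 : Fin n → Type u₁) [∀ i, CStarCategory.{v₁} (𝒟 i)]
    (ℰ : Type u₂) [CStarCategory.{v₂} ℰ] where
  obj : (∀ i, 𝒟 i) → ℰ
  map : ∀ {X Y : ∀ i, 𝒟 i}, (∀ i, X i ⟶ Y i) → (obj X ⟶ obj Y)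
  map_id : ∀ X : ∀ i, 𝒟 i, map (fun i => 𝟙 (X i)) = 𝟙 (obj X)
  map_comp : ∀ {X Y Z : ∀ i, 𝒟 i} (S : ∀ i, X i ⟶ Y i) (T : ∀ i, Y i ⟶ Z i),
    map (fun i => S i ≫ T i) = map S ≫ map T
  map_add : ∀ {X Y : ∀ i, 𝒟 i} (T : ∀ i, X i ⟶ Y i) (i : Fin n) (S S' : X i ⟶ Y i),
    map (Function.update T i (S + S')) =
      map (Function.update T i S) + map (Function.update T i S')
  map_smul : ∀ {X Y : ∀ i, 𝒟 i} (T : ∀ i, X i ⟶ Y i) (i : Fin n) (c : ℂ) (S : X i ⟶ Y i),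
    map (Function.update T i (c • S)) = c • map (Function.update T i S)
  map_adj : ∀ {X Y : ∀ i, 𝒟 i} (T : ∀ i, X i ⟶ Y i), map (fun i => adj (T i)) = adj (map T)

/-- A strict monoidal structure on a C*-category: a unital, strictly associative monoid structure
given by a unit object and a `*`-functor of two variables. -/
structure StrictMonoidal (𝒟 : Type u₁) [CStarCategory.{v₁} 𝒟] where
  unit : 𝒟
  tensorObj : 𝒟 → 𝒟 → 𝒟
  tensorHom : ∀ {X X' Y Y' : 𝒟}, (X ⟶ X') → (Y ⟶ Y') → (tensorObj X Y ⟶ tensorObj X' Y')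
  tensor_id : ∀ X Y : 𝒟, tensorHom (𝟙 X) (𝟙 Y) = 𝟙 (tensorObj X Y)
  tensor_comp : ∀ {X X' X'' Y Y' Y'' : 𝒟} (S : X ⟶ X') (S' : X' ⟶ X'') (T : Y ⟶ Y')
    (T' : Y' ⟶ Y''), tensorHom (S ≫ S') (T ≫ T') = tensorHom S T ≫ tensorHom S' T'
  add_tensor : ∀ {X X' Y Y' : 𝒟} (S S' : X ⟶ X') (T : Y ⟶ Y'),
    tensorHom (S + S') T = tensorHom S T + tensorHom S' T
  tensor_add : ∀ {X X' Y Y' : 𝒟} (S : X ⟶ X') (T T' : Y ⟶ Y'),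
    tensorHom S (T + T') = tensorHom S T + tensorHom S T'
  smul_tensor : ∀ {X X' Y Y' : 𝒟} (c : ℂ) (S : X ⟶ X') (T : Y ⟶ Y'),
    tensorHom (c • S) T = c • tensorHom S T
  tensor_smul : ∀ {X X' Y Y' : 𝒟} (c : ℂ) (S : X ⟶ X') (T : Y ⟶ Y'),
    tensorHom S (c • T) = c • tensorHom S T
  tensor_adj : ∀ {X X' Y Y' : 𝒟} (S : X ⟶ X') (T : Y ⟶ Y'),
    tensorHom (adj S) (adj T) = adj (tensorHom S T)
  assoc_obj : ∀ X Y Z : 𝒟, tensorObj (tensorObj X Y) Z = tensorObj X (tensorObj Y Z)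
  assoc_hom : ∀ {X X' Y Y' Z Z' : 𝒟} (R : X ⟶ X') (S : Y ⟶ Y') (T : Z ⟶ Z'),
    HEq (tensorHom (tensorHom R S) T) (tensorHom R (tensorHom S T))
  unit_tensor_obj : ∀ X : 𝒟, tensorObj unit X = X
  unit_tensor_hom : ∀ {X X' : 𝒟} (T : X ⟶ X'), HEq (tensorHom (𝟙 unit) T) T
  tensor_unit_obj : ∀ X : 𝒟, tensorObj X unit = X
  tensor_unit_hom : ∀ {X X' : 𝒟} (T : X ⟶ X'), HEq (tensorHom T (𝟙 unit)) T

namespace StrictMonoidal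

variable {𝒟 : Type u₁} [CStarCategory.{v₁} 𝒟] (M : StrictMonoidal 𝒟)

/-- The `n`-fold monoidal product of objects, in the given order (the unit for `n = 0`). -/
def prodObj : ∀ {n : ℕ}, (Fin n → 𝒟) → 𝒟
  | 0, _ => M.unit
  | _ + 1, X => M.tensorObj (X 0) (prodObj fun i => X i.succ)

/-- The `n`-fold monoidal product of morphisms, in the given order. -/
def prodHom : ∀ {n : ℕ} {X Y : Fin n → 𝒟}, (∀ i, X i ⟶ Y i) → (M.prodObj X ⟶ M.prodObj Y)
  | 0, _, _, _ => 𝟙 M.unit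
  | _ + 1, _, _, T => M.tensorHom (T 0) (prodHom fun i => T i.succ)

end StrictMonoidal

/-- Strict monoidality of a `*`-functor. -/
structure StarFunctor.IsStrictMonoidal {𝒟 : Type u₁} [CStarCategory.{v₁} 𝒟]
    {ℰ : Type u₂} [CStarCategory.{v₂} ℰ] (F : StarFunctor 𝒟 ℰ)
    (M : StrictMonoidal 𝒟) (N : StrictMonoidal ℰ) : Prop where
  unit : F.obj M.unit = N.unit
  tensorObj : ∀ X Y : 𝒟, F.obj (M.tensorObj X Y) = N.tensorObj (F.obj X) (F.obj Y)
  tensorHom : ∀ {X X' Y Y' : 𝒟} (S : X ⟶ X') (T : Y ⟶ Y'),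
    HEq (F.map (M.tensorHom S T)) (N.tensorHom (F.map S) (F.map T))

/-- Strict monoidality of a `*`-functor of `n` variables, with respect to the componentwise monoidal
structure on the source. -/
structure MultiStarFunctor.IsStrictMonoidal {n : ℕ} {𝒟 : Fin n → Type u₁}
    [∀ i, CStarCategory.{v₁} (𝒟 i)] {ℰ : Type u₂} [CStarCategory.{v₂} ℰ]
    (F : MultiStarFunctor 𝒟 ℰ) (M : ∀ i, StrictMonoidal (𝒟 i)) (N : StrictMonoidal ℰ) :
    Prop where
  unit : F.obj (fun i => (M i).unit) = N.unit
  tensorObj : ∀ X Y : ∀ i, 𝒟 i,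
    F.obj (fun i => (M i).tensorObj (X i) (Y i)) = N.tensorObj (F.obj X) (F.obj Y)
  tensorHom : ∀ {X X' Y Y' : ∀ i, 𝒟 i} (S : ∀ i, X i ⟶ X' i) (T : ∀ i, Y i ⟶ Y' i),
    HEq (F.map (fun i => (M i).tensorHom (S i) (T i))) (N.tensorHom (F.map S) (F.map T))

/-- The full C*-subcategory on the objects satisfying `Q`. -/
structure FullSubcat {𝒟 : Type u₁} (Q : 𝒟 → Prop) where
  obj : 𝒟
  property : Q obj

instance {𝒟 : Type u₁} [CStarCategory.{v₁} 𝒟] (Q : 𝒟 → Prop) :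
    CStarCategory.{v₁} (FullSubcat Q) where
  Hom X Y := X.obj ⟶ Y.obj
  id X := 𝟙 X.obj
  comp T S := T ≫ S
  id_comp := Category.id_comp
  comp_id := Category.comp_id
  assoc := Category.assoc
  homNormedAddCommGroup X Y := inferInstanceAs (NormedAddCommGroup (X.obj ⟶ Y.obj))
  homNormedSpace X Y := inferInstanceAs (NormedSpace ℂ (X.obj ⟶ Y.obj))
  homComplete X Y := inferInstanceAs (CompleteSpace (X.obj ⟶ Y.obj))
  add_comp {X Y Z} := add_comp (X := X.obj) (Y := Y.obj) (Z := Z.obj)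
  comp_add {X Y Z} := comp_add (X := X.obj) (Y := Y.obj) (Z := Z.obj)
  smul_comp {X Y Z} := smul_comp (X := X.obj) (Y := Y.obj) (Z := Z.obj)
  comp_smul {X Y Z} := comp_smul (X := X.obj) (Y := Y.obj) (Z := Z.obj)
  adj {X Y} := adj (X := X.obj) (Y := Y.obj)
  adj_adj {X Y} := adj_adj (X := X.obj) (Y := Y.obj)
  adj_id X := adj_id X.obj
  adj_comp {X Y Z} := adj_comp (X := X.obj) (Y := Y.obj) (Z := Z.obj)
  adj_add {X Y} := adj_add (X := X.obj) (Y := Y.obj)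
  adj_smul {X Y} := adj_smul (X := X.obj) (Y := Y.obj)
  norm_comp_le {X Y Z} := norm_comp_le (X := X.obj) (Y := Y.obj) (Z := Z.obj)
  norm_comp_adj {X Y} := norm_comp_adj (X := X.obj) (Y := Y.obj)
  comp_adj_pos {X Y} := comp_adj_pos (X := X.obj) (Y := Y.obj)

/-! ## Prefactorization algebras valued in strict monoidal C*-categories -/

/-- The structure of a prefactorization algebra, valued in strict monoidal C*-categories, on a
family `𝒟 U` of C*-categories indexed by the objects of an orthogonal category. -/
structure PFA {C : Type u} [Category.{v} C] (P : Orthogonality C) (𝒟 : C → Type u₁)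
    [∀ U, CStarCategory.{v₁} (𝒟 U)] where
  /-- The strict monoidal structures on the values. -/
  mon : ∀ U : C, StrictMonoidal (𝒟 U)
  /-- The factorization products. -/
  prod : ∀ {n : ℕ} {U : Fin n → C} {V : C}, P.Op U V → MultiStarFunctor (fun i => 𝒟 (U i)) (𝒟 V)
  prod_strictMonoidal : ∀ {n : ℕ} {U : Fin n → C} {V : C} (f : P.Op U V),
    (prod f).IsStrictMonoidal (fun i => mon (U i)) (mon V)
  /-- Identity operations act as identities. -/
  id_obj : ∀ (V : C) (X : Fin 1 → 𝒟 V),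
    (prod (Orthogonality.unary (P := P) (𝟙 V))).obj X = X 0
  id_map : ∀ (V : C) {X Y : Fin 1 → 𝒟 V} (T : ∀ i, X i ⟶ Y i),
    HEq ((prod (Orthogonality.unary (P := P) (𝟙 V))).map T) (T 0)
  /-- Compatibility with operadic composition. -/
  comp_obj : ∀ {n : ℕ} {U : Fin n → C} {V : C} (f : P.Op U V) {k : Fin n → ℕ}
    {W : ∀ i, Fin (k i) → C} (g : ∀ i, P.Op (W i) (U i)) (X : ∀ i l, 𝒟 (W i l)),
    (prod (f.comp g)).obj
        (fun j => X (finSigmaFinEquiv.symm j).1 (finSigmaFinEquiv.symm j).2) =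
      (prod f).obj (fun i => (prod (g i)).obj (X i))
  comp_map : ∀ {n : ℕ} {U : Fin n → C} {V : C} (f : P.Op U V) {k : Fin n → ℕ}
    {W : ∀ i, Fin (k i) → C} (g : ∀ i, P.Op (W i) (U i)) {X Y : ∀ i l, 𝒟 (W i l)}
    (T : ∀ i l, X i l ⟶ Y i l),
    HEq ((prod (f.comp g)).map (X := fun j => X (finSigmaFinEquiv.symm j).1
          (finSigmaFinEquiv.symm j).2)
        (fun j => T (finSigmaFinEquiv.symm j).1 (finSigmaFinEquiv.symm j).2))
      ((prod f).map (fun i => (prod (g i)).map (T i)))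
  /-- Compatibility with permutations of the inputs. -/
  perm_obj : ∀ {n : ℕ} {U : Fin n → C} {V : C} (f : P.Op U V) (σ : Equiv.Perm (Fin n))
    (X : ∀ i, 𝒟 (U i)), (prod f).obj X = (prod (f.perm σ)).obj (fun i => X (σ i))
  perm_map : ∀ {n : ℕ} {U : Fin n → C} {V : C} (f : P.Op U V) (σ : Equiv.Perm (Fin n))
    {X Y : ∀ i, 𝒟 (U i)} (T : ∀ i, X i ⟶ Y i),
    HEq ((prod f).map T) ((prod (f.perm σ)).map (fun i => T (σ i)))

/-- Local constancy: every `1`-ary operation is sent to a unitary equivalence, i.e. to a fully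
faithful functor such that each object of the target is unitarily isomorphic to one in the image. -/
def PFA.LocallyConstant {C : Type u} [Category.{v} C] {P : Orthogonality C} {𝒟 : C → Type u₁}
    [∀ U, CStarCategory.{v₁} (𝒟 U)] (𝓕 : PFA P 𝒟) : Prop :=
  ∀ {U V : C} (f : U ⟶ V),
    (∀ X Y : 𝒟 U, Function.Bijective fun T : X ⟶ Y =>
      (𝓕.prod (Orthogonality.unary (P := P) f)).map (X := fun _ => X) (Y := fun _ => Y)
        (fun _ => T)) ∧
    ∀ Z : 𝒟 V, ∃ (X : 𝒟 U)
      (T : (𝓕.prod (Orthogonality.unary (P := P) f)).obj (fun _ => X) ⟶ Z), IsUnitaryHom T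

/-- The structure of a `G`-equivariant prefactorization algebra: a prefactorization algebra together
with strict monoidal `*`-functors `Ψ_g : 𝒟(U) → 𝒟(α_g(U))`, compatible with the factorization
products and satisfying `Ψ_1 = id` and `Ψ_{g'g} = Ψ_{g'} Ψ_g`; in particular every `Ψ_g` is
invertible. Values on equal objects of `C` are identified through the identity morphism
`eqToHom _` of `C`. -/
structure EquivariantPFA {C : Type u} [Category.{v} C] {P : Orthogonality C} {G : Type w}
    [Group G] (α : P.GroupAction G) (𝒟 : C → Type u₁) [∀ U, CStarCategory.{v₁} (𝒟 U)]
    extends PFA P 𝒟 where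
  act : ∀ (g : G) (U : C), StarFunctor (𝒟 U) (𝒟 (α.obj g U))
  act_strictMonoidal : ∀ (g : G) (U : C),
    (act g U).IsStrictMonoidal (mon U) (mon (α.obj g U))
  act_prod_obj : ∀ (g : G) {n : ℕ} {U : Fin n → C} {V : C} (f : P.Op U V) (X : ∀ i, 𝒟 (U i)),
    (act g V).obj ((prod f).obj X) = (prod (α.mapOp g f)).obj (fun i => (act g (U i)).obj (X i))
  act_prod_map : ∀ (g : G) {n : ℕ} {U : Fin n → C} {V : C} (f : P.Op U V)
    {X Y : ∀ i, 𝒟 (U i)} (T : ∀ i, X i ⟶ Y i),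
    HEq ((act g V).map ((prod f).map T))
      ((prod (α.mapOp g f)).map (fun i => (act g (U i)).map (T i)))
  act_one_obj : ∀ (U : C) (X : 𝒟 U),
    (prod (Orthogonality.unary (P := P) (eqToHom (α.obj_one U)))).obj
      (fun _ => (act 1 U).obj X) = X
  act_one_map : ∀ (U : C) {X Y : 𝒟 U} (T : X ⟶ Y),
    HEq ((prod (Orthogonality.unary (P := P) (eqToHom (α.obj_one U)))).map
      (fun _ => (act 1 U).map T)) T
  act_mul_obj : ∀ (g' g : G) (U : C) (X : 𝒟 U),
    (prod (Orthogonality.unary (P := P) (eqToHom (α.obj_mul g' g U)))).obj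
      (fun _ => (act (g' * g) U).obj X) = (act g' (α.obj g U)).obj ((act g U).obj X)
  act_mul_map : ∀ (g' g : G) (U : C) {X Y : 𝒟 U} (T : X ⟶ Y),
    HEq ((prod (Orthogonality.unary (P := P) (eqToHom (α.obj_mul g' g U)))).map
      (fun _ => (act (g' * g) U).map T)) ((act g' (α.obj g U)).map ((act g U).map T))

/-- The structure `𝓕'` on a family of full C*-subcategories is the restriction of the structure `𝓕`:
units, monoidal products, factorization products and the `G`-action are those of `𝓕`. -/
structure EquivariantPFA.IsRestriction {C : Type u} [Category.{v} C] {P : Orthogonality C}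
    {G : Type w} [Group G] {α : P.GroupAction G} {𝒟 : C → Type u₁}
    [∀ U, CStarCategory.{v₁} (𝒟 U)] (𝓕 : EquivariantPFA α 𝒟) {Q : ∀ U, 𝒟 U → Prop}
    (𝓕' : EquivariantPFA α (fun U => FullSubcat (Q U))) : Prop where
  unit : ∀ U, (𝓕'.mon U).unit.obj = (𝓕.mon U).unit
  tensorObj : ∀ (U : C) (X Y : FullSubcat (Q U)),
    ((𝓕'.mon U).tensorObj X Y).obj = (𝓕.mon U).tensorObj X.obj Y.obj
  tensorHom : ∀ (U : C) {X X' Y Y' : FullSubcat (Q U)} (S : X ⟶ X') (T : Y ⟶ Y'),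
    HEq ((𝓕'.mon U).tensorHom S T)
      ((𝓕.mon U).tensorHom (show X.obj ⟶ X'.obj from S) (show Y.obj ⟶ Y'.obj from T))
  prod_obj : ∀ {n : ℕ} {U : Fin n → C} {V : C} (f : P.Op U V) (X : ∀ i, FullSubcat (Q (U i))),
    ((𝓕'.prod f).obj X).obj = (𝓕.prod f).obj (fun i => (X i).obj)
  prod_map : ∀ {n : ℕ} {U : Fin n → C} {V : C} (f : P.Op U V)
    {X Y : ∀ i, FullSubcat (Q (U i))} (T : ∀ i, X i ⟶ Y i),
    HEq ((𝓕'.prod f).map T)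
      ((𝓕.prod f).map (fun i => (show (X i).obj ⟶ (Y i).obj from T i)))
  act_obj : ∀ (g : G) (U : C) (X : FullSubcat (Q U)),
    ((𝓕'.act g U).obj X).obj = (𝓕.act g U).obj X.obj
  act_map : ∀ (g : G) (U : C) {X Y : FullSubcat (Q U)} (T : X ⟶ Y),
    HEq ((𝓕'.act g U).map T) ((𝓕.act g U).map (show X.obj ⟶ Y.obj from T))

/-! ## Algebraic quantum field theories and their representations -/

/-- A C*-algebraic AQFT over an orthogonal category: a `⊥`-commutative functor to unital
C*-algebras and unital `*`-homomorphisms. -/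
structure AQFT {C : Type u} [Category.{v} C] (P : Orthogonality C) where
  obj : C → Type w
  [cstar : ∀ U, CStarAlgebra (obj U)]
  map : ∀ {U V : C}, (U ⟶ V) → (obj U →⋆ₐ[ℂ] obj V)
  map_id : ∀ (U : C) (a : obj U), map (𝟙 U) a = a
  map_comp : ∀ {U V W : C} (f : U ⟶ V) (g : V ⟶ W) (a : obj U), map (f ≫ g) a = map g (map f a)
  perp_commute : ∀ {U₁ U₂ V : C} (f₁ : U₁ ⟶ V) (f₂ : U₂ ⟶ V), P.perp f₁ f₂ →
    ∀ (a : obj U₁) (b : obj U₂), map f₁ a * map f₂ b = map f₂ b * map f₁ a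

attribute [instance] AQFT.cstar

/-- A `G`-equivariance structure on an AQFT: natural `*`-isomorphisms
`Ψ_g : 𝔄(U) ≅ 𝔄(α_g(U))` with `Ψ_1 = id` and `Ψ_{g'g} = Ψ_{g'} Ψ_g`. -/
structure AQFT.Equivariance {C : Type u} [Category.{v} C] {P : Orthogonality C}
    (A : AQFT.{v, u, w} P) {G : Type*} [Group G] (α : P.GroupAction G) where
  iso : ∀ (g : G) (U : C), A.obj U ≃⋆ₐ[ℂ] A.obj (α.obj g U)
  natural : ∀ (g : G) {U V : C} (f : U ⟶ V) (a : A.obj U),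
    iso g V (A.map f a) = A.map ((α.functor g).map f) (iso g U a)
  iso_one : ∀ (U : C) (a : A.obj U), A.map (eqToHom (α.obj_one U)) (iso 1 U a) = a
  iso_mul : ∀ (g' g : G) (U : C) (a : A.obj U),
    A.map (eqToHom (α.obj_mul g' g U)) (iso (g' * g) U a) = iso g' (α.obj g U) (iso g U a)

section Hilbert

variable {C : Type u} [Category.{v} C] {P : Orthogonality C}
  {H : Type w'} [NormedAddCommGroup H] [InnerProductSpace ℂ H] [CompleteSpace H]

/-- A representation of an AQFT on a Hilbert space: a compatible family of (unital)
representations of the local algebras. By the universal property of the colimit this is the same as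
a `*`-homomorphism `𝔄⋆ → B(H)` out of the universal C*-algebra `𝔄⋆ = colim 𝔄`. -/
structure AQFT.Representation (A : AQFT.{v, u, w} P) (H : Type w') [NormedAddCommGroup H]
    [InnerProductSpace ℂ H] [CompleteSpace H] where
  rep : ∀ U : C, A.obj U →⋆ₐ[ℂ] (H →L[ℂ] H)
  compatible : ∀ {U V : C} (f : U ⟶ V) (a : A.obj U), rep V (A.map f a) = rep U a

variable {A : AQFT.{v, u, w} P}

namespace AQFT.Representation

variable (π₀ : A.Representation H)

/-- The local von Neumann algebra `π₀(𝔄(U))''`. -/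
def vN (U : C) : StarSubalgebra ℂ (H →L[ℂ] H) :=
  StarSubalgebra.centralizer ℂ
    (StarSubalgebra.centralizer ℂ (Set.range (π₀.rep U)) : Set (H →L[ℂ] H))

theorem star_range (U : C) : star (Set.range (π₀.rep U)) = Set.range (π₀.rep U) := by
  ext T
  constructor
  · rintro ⟨a, ha⟩
    exact ⟨star a, by rw [map_star, ha, star_star]⟩
  · rintro ⟨a, rfl⟩
    exact ⟨star a, by rw [map_star]⟩

theorem coe_vN (U : C) :
    (π₀.vN U : Set (H →L[ℂ] H)) = (Set.range (π₀.rep U)).centralizer.centralizer := by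
  rw [vN, StarSubalgebra.coe_centralizer_centralizer, star_range, Set.union_self]

theorem vN_mono {U V : C} (f : U ⟶ V) : π₀.vN U ≤ π₀.vN V := by
  have h : Set.range (π₀.rep U) ⊆ Set.range (π₀.rep V) := by
    rintro _ ⟨a, rfl⟩
    exact ⟨A.map f a, π₀.compatible f a⟩
  exact StarSubalgebra.centralizer_le ℂ _ _ (StarSubalgebra.centralizer_le ℂ _ _ h)

theorem isClosed_vN (U : C) : IsClosed (π₀.vN U : Set (H →L[ℂ] H)) := by
  rw [coe_vN]
  exact Set.isClosed_centralizer _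

/-- The universal C*-algebra `π₀(𝔄)''⋆ ⊆ B(H)` of the AQFT `U ↦ π₀(𝔄(U))''`: the norm closure of
the union of the local von Neumann algebras, which is directed when `C` is filtered. This is the
colimit of these algebras along their inclusions. -/
def univ : StarSubalgebra ℂ (H →L[ℂ] H) := (⨆ U : C, π₀.vN U).topologicalClosure

theorem vN_le_univ (U : C) : π₀.vN U ≤ π₀.univ :=
  (le_iSup π₀.vN U).trans (StarSubalgebra.le_topologicalClosure _)

/-- The inclusion of `π₀(𝔄(U))''` into the universal algebra. -/
def incl (U : C) : π₀.vN U →⋆ₐ[ℂ] π₀.univ := StarSubalgebra.inclusion (π₀.vN_le_univ U)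

/-- All local representations are faithful. -/
def LocallyFaithful : Prop := ∀ U : C, Function.Injective (π₀.rep U)

/-- Haag duality: `π₀(𝔄(U))''` is the intersection of the commutants `π₀(𝔄(U'))'` over all
orthogonal cospans `(U' ⟶ V) ⊥ (U ⟶ V)`. -/
def HaagDuality : Prop :=
  ∀ U : C, (Set.range (π₀.rep U)).centralizer.centralizer =
    ⋂ (U' : C) (V : C) (f' : U' ⟶ V) (f : U ⟶ V) (_ : P.perp f' f),
      (Set.range (π₀.rep U')).centralizer

end AQFT.Representation

/-! ## Strictly localized superselection sectors -/

/-- Objects of the C*-category of strictly `U`-localized superselection sectors: `*`-endomorphisms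
of the universal algebra that are localizable in every region and strictly localized in `U`. -/
structure Sector (π₀ : A.Representation H) (U : C) where
  hom : π₀.univ →⋆ₐ[ℂ] π₀.univ
  localizable : ∀ W : C, ∃ w : unitary (H →L[ℂ] H),
    ∀ {W' V : C} (f' : W' ⟶ V) (f : W ⟶ V), P.perp f' f →
      ∀ a : π₀.vN W', (w : H →L[ℂ] H) * (hom (π₀.incl W' a) : H →L[ℂ] H) =
        (π₀.incl W' a : H →L[ℂ] H) * (w : H →L[ℂ] H)
  localized : ∀ {U' V : C} (f' : U' ⟶ V) (f : U ⟶ V), P.perp f' f →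
    ∀ a : π₀.vN U', hom (π₀.incl U' a) = π₀.incl U' a

namespace Sector

variable {π₀ : A.Representation H}

/-- Morphisms `ρ → ρ'` of `U`-localized sectors: elements `T ∈ π₀(𝔄(U))''` with
`T ρ(a) = ρ'(a) T` for all `a` in the universal algebra. -/
def homs {U : C} (ρ ρ' : Sector π₀ U) : Submodule ℂ (H →L[ℂ] H) where
  carrier := {T | T ∈ π₀.vN U ∧
    ∀ a : π₀.univ, T * (ρ.hom a : H →L[ℂ] H) = (ρ'.hom a : H →L[ℂ] H) * T}
  add_mem' := by
    rintro S T ⟨hS, hS'⟩ ⟨hT, hT'⟩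
    exact ⟨add_mem hS hT, fun a => by rw [add_mul, mul_add, hS', hT']⟩
  zero_mem' := ⟨zero_mem _, fun a => by rw [zero_mul, mul_zero]⟩
  smul_mem' := by
    rintro c T ⟨hT, hT'⟩
    exact ⟨(π₀.vN U).smul_mem hT c, fun a => by rw [smul_mul_assoc, mul_smul_comm, hT']⟩

theorem isClosed_homs {U : C} (ρ ρ' : Sector π₀ U) :
    IsClosed (ρ.homs ρ' : Set (H →L[ℂ] H)) := by
  have h : (ρ.homs ρ' : Set (H →L[ℂ] H)) = (π₀.vN U : Set (H →L[ℂ] H)) ∩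
      ⋂ a : π₀.univ, {T | T * (ρ.hom a : H →L[ℂ] H) = (ρ'.hom a : H →L[ℂ] H) * T} := by
    ext T
    simp [homs]
  rw [h]
  refine (π₀.isClosed_vN U).inter (isClosed_iInter fun a => ?_)
  exact isClosed_eq (continuous_id.mul continuous_const) (continuous_const.mul continuous_id)

theorem star_mem_homs {U : C} {ρ ρ' : Sector π₀ U} {T : H →L[ℂ] H} (hT : T ∈ ρ.homs ρ') :
    star T ∈ ρ'.homs ρ := by
  refine ⟨star_mem hT.1, fun a => ?_⟩
  have h := congrArg star (hT.2 (star a))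
  simp only [map_star, star_mul, StarMemClass.coe_star, star_star] at h
  exact h.symm

theorem mul_mem_homs {U : C} {ρ ρ' ρ'' : Sector π₀ U} {T S : H →L[ℂ] H} (hT : T ∈ ρ.homs ρ')
    (hS : S ∈ ρ'.homs ρ'') : S * T ∈ ρ.homs ρ'' :=
  ⟨mul_mem hS.1 hT.1, fun a => by rw [mul_assoc, hT.2, ← mul_assoc, hS.2, mul_assoc]⟩

theorem exists_sqrt {U : C} {ρ ρ' : Sector π₀ U} {T : H →L[ℂ] H} (hT : T ∈ ρ.homs ρ') :
    ∃ S ∈ ρ.homs ρ, star T * T = star S * S := by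
  have hTT : star T * T ∈ ρ.homs ρ := mul_mem_homs hT (star_mem_homs hT)
  have hnn : 0 ≤ star T * T := star_mul_self_nonneg T
  have hcomm : ∀ b : H →L[ℂ] H, Commute (star T * T) b → Commute (CFC.sqrt (star T * T)) b :=
    fun b hb => Commute.cfcₙ_nnreal hb _
  refine ⟨CFC.sqrt (star T * T), ⟨?_, fun a => hcomm _ (hTT.2 a)⟩, ?_⟩
  · rw [← SetLike.mem_coe, π₀.coe_vN]
    intro b hb
    have h1 : star T * T ∈ (π₀.vN U : Set (H →L[ℂ] H)) := hTT.1
    rw [π₀.coe_vN] at h1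
    exact (hcomm b (h1 b hb).symm).eq.symm
  · rw [(IsSelfAdjoint.of_nonneg (CFC.sqrt_nonneg (star T * T))).star_eq, CFC.sqrt_mul_sqrt_self _ hnn]

/-- The C*-category of strictly `U`-localized superselection sectors: composition is composition of
operators, the involution is the adjoint, the norm is the operator norm. -/
instance (U : C) : CStarCategory (Sector π₀ U) where
  Hom ρ ρ' := ρ.homs ρ'
  id ρ := ⟨1, one_mem _, fun a => by rw [one_mul, mul_one]⟩
  comp T S := ⟨S.1 * T.1, mul_mem_homs T.2 S.2⟩
  id_comp T := Subtype.ext (mul_one _)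
  comp_id T := Subtype.ext (one_mul _)
  assoc R S T := Subtype.ext (mul_assoc _ _ _).symm
  homNormedAddCommGroup ρ ρ' := inferInstanceAs (NormedAddCommGroup (ρ.homs ρ'))
  homNormedSpace ρ ρ' := inferInstanceAs (NormedSpace ℂ (ρ.homs ρ'))
  homComplete ρ ρ' := (isClosed_homs ρ ρ').completeSpace_coe
  add_comp S T R := Subtype.ext (mul_add R.1 S.1 T.1)
  comp_add R S T := Subtype.ext (add_mul S.1 T.1 R.1)
  smul_comp c S R := Subtype.ext (mul_smul_comm c R.1 S.1)
  comp_smul c R S := Subtype.ext (smul_mul_assoc c S.1 R.1)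
  adj T := ⟨star T.1, star_mem_homs T.2⟩
  adj_adj T := Subtype.ext (star_star T.1)
  adj_id ρ := Subtype.ext (star_one _)
  adj_comp T S := Subtype.ext (star_mul S.1 T.1)
  adj_add S T := Subtype.ext (star_add S.1 T.1)
  adj_smul c T := Subtype.ext (star_smul c T.1)
  norm_comp_le T S := norm_mul_le S.1 T.1
  norm_comp_adj T := by
    have h := CStarRing.norm_star_mul_self (x := T.1)
    rw [← sq] at h
    exact h
  comp_adj_pos T := by
    obtain ⟨S, hS, h⟩ := exists_sqrt T.2
    exact ⟨⟨S, hS⟩, Subtype.ext h⟩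

/-- The operator underlying a morphism of sectors. -/
def op {U : C} {ρ ρ' : Sector π₀ U} (T : ρ ⟶ ρ') : H →L[ℂ] H := (T : ρ.homs ρ').1

theorem op_mem {U : C} {ρ ρ' : Sector π₀ U} (T : ρ ⟶ ρ') : op T ∈ π₀.vN U :=
  (T : ρ.homs ρ').2.1

/-- A morphism of sectors as an element of the universal algebra. -/
def opUniv {U : C} {ρ ρ' : Sector π₀ U} (T : ρ ⟶ ρ') : π₀.univ := π₀.incl U ⟨op T, op_mem T⟩

/-- The inclusion of `U`-localized into `V`-localized sectors along `f : U ⟶ V`, on objects. -/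
def extend {U V : C} (f : U ⟶ V) (ρ : Sector π₀ U) : Sector π₀ V where
  hom := ρ.hom
  localizable := ρ.localizable
  localized f' k h := ρ.localized f' (f ≫ k) (by
    simpa using P.precomp (𝟙 _) f h)

/-- The inclusion of `U`-localized into `V`-localized sectors along `f : U ⟶ V`, on morphisms. -/
def extendHom {U V : C} (f : U ⟶ V) {ρ ρ' : Sector π₀ U} (T : ρ ⟶ ρ') :
    extend f ρ ⟶ extend f ρ' :=
  (⟨op T, π₀.vN_mono f (op_mem T), (T : ρ.homs ρ').2.2⟩ : (extend f ρ).homs (extend f ρ'))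

end Sector

/-! ## Projective unitary representations and covariant sectors -/

variable (H) in
/-- The scalar unitary operators. -/
def scalarUnitaries : Subgroup (unitary (H →L[ℂ] H)) where
  carrier := {w | ∃ z : ℂ, (w : H →L[ℂ] H) = z • 1}
  mul_mem' := by
    rintro a b ⟨z, hz⟩ ⟨z', hz'⟩
    exact ⟨z * z', by simp [hz, hz', smul_smul, mul_comm]⟩
  one_mem' := ⟨1, by simp⟩
  inv_mem' := by
    rintro a ⟨z, hz⟩
    exact ⟨star z, by simp [← Unitary.star_eq_inv, hz]⟩

instance : (scalarUnitaries H).Normal where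
  conj_mem := by
    rintro a ⟨z, hz⟩ b
    refine ⟨z, ?_⟩
    simp [hz, ← Unitary.star_eq_inv]

variable (H) in
/-- The projective unitary group `PU(H) = U(H) / U(1)`. -/
abbrev PU : Type w' := unitary (H →L[ℂ] H) ⧸ scalarUnitaries H

variable (H) in
/-- The adjoint action `Ad_w(T) = w T w*` of `PU(H)` on `B(H)`. -/
def Ad : PU H →* ((H →L[ℂ] H) ≃⋆ₐ[ℂ] (H →L[ℂ] H)) :=
  QuotientGroup.lift (scalarUnitaries H) (Unitary.conjStarAlgAut ℂ (H →L[ℂ] H)) (by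
    rintro a ⟨z, hz⟩
    ext1 T
    have h1 : (a : H →L[ℂ] H) * star (a : H →L[ℂ] H) = 1 := Unitary.coe_mul_star_self a
    have h2 : (a : H →L[ℂ] H) * T = T * a := by simp [hz]
    rw [Unitary.conjStarAlgAut_apply, h2, mul_assoc]
    simp [h1])

@[simp] theorem Ad_mk (a : unitary (H →L[ℂ] H)) (T : H →L[ℂ] H) :
    Ad H (QuotientGroup.mk a) T = a * T * star (a : H →L[ℂ] H) := rfl

/-- A projective unitary representation `u : G → PU(H)` implementing the equivariance structure `Ψ`
in the representation `π₀`: `π₀ Ψ_g = Ad_{u_g} π₀` on each local algebra. -/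
structure Implementation {G : Type*} [Group G] {α : P.GroupAction G} (Ψ : A.Equivariance α)
    (π₀ : A.Representation H) where
  u : G →* PU H
  implements : ∀ (g : G) (U : C) (a : A.obj U),
    π₀.rep (α.obj g U) (Ψ.iso g U a) = Ad H (u g) (π₀.rep U a)

namespace Implementation

variable {G : Type*} [Group G] {α : P.GroupAction G} {Ψ : A.Equivariance α}
  {π₀ : A.Representation H} (u : Implementation Ψ π₀)

theorem Ad_mem_vN (g : G) (U : C) {T : H →L[ℂ] H} (hT : T ∈ π₀.vN U) :
    Ad H (u.u g) T ∈ π₀.vN (α.obj g U) := by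
  rw [← SetLike.mem_coe, π₀.coe_vN] at hT ⊢
  intro b hb
  have hb' : (Ad H (u.u g)).symm b ∈ (Set.range (π₀.rep U)).centralizer := by
    rintro _ ⟨a, rfl⟩
    have h1 : Ad H (u.u g) (π₀.rep U a) * b = b * Ad H (u.u g) (π₀.rep U a) := by
      rw [← u.implements]
      exact hb _ ⟨_, rfl⟩
    have h2 := congrArg (Ad H (u.u g)).symm h1
    simpa only [map_mul, StarAlgEquiv.symm_apply_apply] using h2
  have h := congrArg (Ad H (u.u g)) (hT _ hb')
  simpa only [map_mul, StarAlgEquiv.apply_symm_apply] using h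

theorem continuous_Ad (w : PU H) : Continuous (Ad H w) := by
  induction w using QuotientGroup.induction_on with
  | H a =>
    change Continuous fun T : H →L[ℂ] H => (a : H →L[ℂ] H) * T * star (a : H →L[ℂ] H)
    exact (continuous_const.mul continuous_id).mul continuous_const

theorem Ad_mem_univ (g : G) {T : H →L[ℂ] H} (hT : T ∈ π₀.univ) :
    Ad H (u.u g) T ∈ π₀.univ := by
  have h : (⨆ U : C, π₀.vN U) ≤ π₀.univ.comap (Ad H (u.u g)).toStarAlgHom :=
    iSup_le fun U T hT => π₀.vN_le_univ _ (u.Ad_mem_vN g U hT)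
  refine StarSubalgebra.topologicalClosure_minimal h ?_ hT
  exact (StarSubalgebra.isClosed_topologicalClosure _).preimage (continuous_Ad (u.u g))

/-- The action `Ad_{u_g}` on the universal algebra. -/
def ad (g : G) : π₀.univ →⋆ₐ[ℂ] π₀.univ :=
  StarAlgHom.codRestrict
    ((Ad H (u.u g)).toStarAlgHom.comp π₀.univ.subtype) π₀.univ
    (fun a => u.Ad_mem_univ g a.2)

@[simp] theorem coe_ad (g : G) (a : π₀.univ) :
    (u.ad g a : H →L[ℂ] H) = Ad H (u.u g) (a : H →L[ℂ] H) := rfl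

/-- A sector `ρ` is covariant if `ρ Ad_{u_g} = Ad_{u^ρ_g} ρ` for all `g`, for some projective
unitary representation `u^ρ`. -/
def IsCovariant {U : C} (ρ : Sector π₀ U) : Prop :=
  ∃ uρ : G →* PU H, ∀ (g : G) (a : π₀.univ),
    (ρ.hom (u.ad g a) : H →L[ℂ] H) = Ad H (uρ g) (ρ.hom a : H →L[ℂ] H)

/-- The C*-category of covariant superselection sectors strictly localized in `U`, a full
C*-subcategory of the `U`-localized sectors. -/
abbrev CovariantSector (U : C) := FullSubcat (fun ρ : Sector π₀ U => u.IsCovariant ρ)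

/-- The equivariant prefactorization algebra structure `𝓕` on the sectors is the standard one:
* monoidal unit `id`, products `ρ ◇ σ = ρ σ` and `T ◇ S = T ρ(S)`;
* factorization products: include all inputs in the sectors over the target, then multiply;
* group action `g ▷ ρ = Ad_{u_g} ρ Ad_{u_g}⁻¹` and `g ▷ T = Ad_{u_g}(T)`. -/
structure IsStandard (𝓕 : EquivariantPFA α (fun U => Sector π₀ U)) : Prop where
  unit : ∀ U : C, (𝓕.mon U).unit.hom = StarAlgHom.id ℂ π₀.univ
  tensorObj : ∀ (U : C) (ρ σ : Sector π₀ U),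
    ((𝓕.mon U).tensorObj ρ σ).hom = ρ.hom.comp σ.hom
  tensorHom : ∀ (U : C) {ρ ρ' σ σ' : Sector π₀ U} (T : ρ ⟶ ρ') (S : σ ⟶ σ'),
    Sector.op ((𝓕.mon U).tensorHom T S) =
      Sector.op T * (ρ.hom (Sector.opUniv S) : H →L[ℂ] H)
  prod_obj : ∀ {n : ℕ} {U : Fin n → C} {V : C} (f : P.Op U V) (ρ : ∀ i, Sector π₀ (U i)),
    (𝓕.prod f).obj ρ = (𝓕.mon V).prodObj (fun i => Sector.extend (f.1 i) (ρ i))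
  prod_map : ∀ {n : ℕ} {U : Fin n → C} {V : C} (f : P.Op U V) {ρ ρ' : ∀ i, Sector π₀ (U i)}
    (T : ∀ i, ρ i ⟶ ρ' i), Sector.op ((𝓕.prod f).map T) =
      Sector.op ((𝓕.mon V).prodHom (fun i => Sector.extendHom (f.1 i) (T i)))
  act_obj : ∀ (g : G) (U : C) (ρ : Sector π₀ U),
    ((𝓕.act g U).obj ρ).hom = (u.ad g).comp (ρ.hom.comp (u.ad g⁻¹))
  act_map : ∀ (g : G) (U : C) {ρ ρ' : Sector π₀ U} (T : ρ ⟶ ρ'),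
    Sector.op ((𝓕.act g U).map T) = Ad H (u.u g) (Sector.op T)

end Implementation

end Hilbert

end

end Superselection

open Superselection

namespace Superselection

noncomputable section

open CStarCategory

/-! The engine is Haag duality in the form `HaagDuality.mem_vN`: an operator commuting with every
`𝔐(U')`, `U'` orthogonal to `U`, lies in `𝔐(U)`. It shows that a `U`-localized sector maps `𝔐(U)`
into itself, that every intertwiner of `U`-localized sectors lies in `𝔐(U)`, and that a unitary
moving a charge from `U` to `W` lies in `𝔐(V)` for any `V` receiving both. As `C` is filtered, such
charge transporters belong to the universal algebra, so sectors can be applied to them.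

The geometric input is that sectors localized in orthogonal regions commute
(`Sector.hom_comp_comm`). On an observable `a`, separation allows both charges to be moved off the
region of `a` by transporters `w₁ ∈ 𝔐(V₁)`, `w₂ ∈ 𝔐(V₂)` with `V₁ ⊥ V₂`. Then `ρ` and `σ` act on `a`
as conjugation by `w₁*` and `w₂*`; each sector fixes the transporter of the other, and the
transporters commute.

For pairwise orthogonal inputs the twist in `T ◇ S = T ρ(S)` disappears, because `ρ` fixes operators
of orthogonal regions. Factorization products are therefore ordered products of commuting
endomorphisms and of commuting operators, and the operadic axioms become identities about such
products in a monoid. The group acts by conjugation, which respects all of this.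

Local constancy: an intertwiner over the larger region between sectors localized in the smaller one
is already local there, and conjugation by a transporter moves any sector into the smaller region.

Covariant sectors are closed under products because `z_g = u^σ_g u_g*` intertwines `g ▷ σ` with `σ`,
hence lies in the universal algebra, so that `g ↦ ρ(z_g) u^ρ_g` makes sense; it implements the
symmetry on `ρσ` (`IsCovariant.comp`). -/

theorem continuous_starAlgHom {B : Type*} [CStarAlgebra B] (φ : B →⋆ₐ[ℂ] B) : Continuous φ :=
  (NonUnitalStarAlgHom.instContinuousLinearMapClassComplex (F := B →⋆ₐ[ℂ] B)).map_continuous φ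

/-! ### Locality, Haag duality and charge transporters -/

section Hilbert

variable {C : Type u} [Category.{v} C] {P : Orthogonality C}
  {H : Type w'} [NormedAddCommGroup H] [InnerProductSpace ℂ H] [CompleteSpace H]
  {A : AQFT.{v, u, w} P} {π₀ : A.Representation H}

namespace AQFT.Representation

theorem rep_mem_vN (U : C) (a : A.obj U) : π₀.rep U a ∈ π₀.vN U := by
  rw [← SetLike.mem_coe, π₀.coe_vN]
  exact Set.subset_centralizer_centralizer ⟨a, rfl⟩

/-- Locality passes to bicommutants: `S₂ ⊆ S₁'` gives `S₂'' ⊆ S₁''' = S₁'`. -/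
theorem vN_commute {U₁ U₂ V : C} {f₁ : U₁ ⟶ V} {f₂ : U₂ ⟶ V} (h : P.perp f₁ f₂)
    {a b : H →L[ℂ] H} (ha : a ∈ π₀.vN U₁) (hb : b ∈ π₀.vN U₂) : Commute a b := by
  rw [← SetLike.mem_coe, π₀.coe_vN] at ha hb
  have h12 : Set.range (π₀.rep U₂) ⊆ (Set.range (π₀.rep U₁)).centralizer := by
    rintro _ ⟨y, rfl⟩ _ ⟨x, rfl⟩
    rw [← π₀.compatible f₁, ← π₀.compatible f₂, ← map_mul, ← map_mul, A.perp_commute f₁ f₂ h]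
  have hb' := Set.centralizer_subset (Set.centralizer_subset h12) hb
  rw [Set.centralizer_centralizer_centralizer] at hb'
  exact (ha b hb').symm

/-- Haag duality in terms of the local von Neumann algebras. -/
theorem HaagDuality.mem_vN (hHaag : π₀.HaagDuality) {U : C} {T : H →L[ℂ] H}
    (h : ∀ {U' V : C} (f' : U' ⟶ V) (f : U ⟶ V), P.perp f' f →
      ∀ b ∈ π₀.vN U', Commute b T) : T ∈ π₀.vN U := by
  rw [← SetLike.mem_coe, π₀.coe_vN, hHaag U]
  simp only [Set.mem_iInter]
  rintro U' V f' f hp _ ⟨a, rfl⟩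
  exact h f' f hp _ (rep_mem_vN U' a)

theorem isClosed_univ : IsClosed (π₀.univ : Set (H →L[ℂ] H)) :=
  StarSubalgebra.isClosed_topologicalClosure _

theorem continuous_univ_hom (φ : π₀.univ →⋆ₐ[ℂ] π₀.univ) : Continuous φ := by
  let _ : CStarAlgebra π₀.univ := StarSubalgebra.cstarAlgebra π₀.univ (h_closed := isClosed_univ)
  exact continuous_starAlgHom φ

/-- An endomorphism of the universal algebra is determined by its values on the local algebras. -/
theorem univ_hom_ext {φ ψ : π₀.univ →⋆ₐ[ℂ] π₀.univ}
    (h : ∀ (U : C) (a : π₀.univ), (a : H →L[ℂ] H) ∈ π₀.vN U → φ a = ψ a) : φ = ψ := by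
  refine StarAlgHom.ext_topologicalClosure (S := ⨆ U : C, π₀.vN U)
    (continuous_univ_hom φ) (continuous_univ_hom ψ) ?_
  -- The set where `φ` and `ψ` agree is a `*`-subalgebra, so containing each local algebra it
  -- contains the one they generate; continuity handles the closure.
  have key : (⨆ U : C, π₀.vN U) ≤ (StarAlgHom.equalizer φ ψ).map π₀.univ.subtype :=
    iSup_le fun U a ha => ⟨π₀.incl U ⟨a, ha⟩, h U _ ha, rfl⟩
  ext1 x
  obtain ⟨y, hy, hyx⟩ := key x.2
  have : y = StarSubalgebra.inclusion (StarSubalgebra.le_topologicalClosure _) x :=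
    Subtype.ext hyx
  subst this
  exact hy

end AQFT.Representation

open AQFT.Representation

namespace Sector

@[ext]
theorem ext {U : C} {ρ σ : Sector π₀ U} (h : ρ.hom = σ.hom) : ρ = σ := by
  cases ρ; cases σ; cases h; rfl

variable {U V : C}

theorem hom_eq_self (ρ : Sector π₀ U) {U' V : C} {f' : U' ⟶ V} {f : U ⟶ V} (h : P.perp f' f)
    {a : π₀.univ} (ha : (a : H →L[ℂ] H) ∈ π₀.vN U') : ρ.hom a = a :=
  ρ.localized f' f h ⟨a, ha⟩

/-- An observable `b` of an orthogonal region commutes with `a` and is fixed by `ρ`, so it commutes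
with `ρ(a)`; Haag duality concludes. -/
theorem hom_mem_vN (hHaag : π₀.HaagDuality) (ρ : Sector π₀ U) {a : π₀.univ}
    (ha : (a : H →L[ℂ] H) ∈ π₀.vN U) : (ρ.hom a : H →L[ℂ] H) ∈ π₀.vN U := by
  refine hHaag.mem_vN fun {U' V} f' f h b hb => ?_
  have hab : π₀.incl U' ⟨b, hb⟩ * a = a * π₀.incl U' ⟨b, hb⟩ :=
    Subtype.ext (vN_commute h hb ha)
  have := congrArg ρ.hom hab
  rw [map_mul, map_mul, ρ.hom_eq_self h (a := π₀.incl U' ⟨b, hb⟩) hb] at this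
  exact congrArg Subtype.val this

/-- `w` transports the charge `ρ` to the region `W`. -/
def Transports (ρ : Sector π₀ U) (W : C) (w : H →L[ℂ] H) : Prop :=
  ∀ {W' V : C} {f' : W' ⟶ V} {f : W ⟶ V}, P.perp f' f → ∀ {a : π₀.univ},
    (a : H →L[ℂ] H) ∈ π₀.vN W' → w * (ρ.hom a : H →L[ℂ] H) = (a : H →L[ℂ] H) * w

theorem exists_transports (ρ : Sector π₀ U) (W : C) :
    ∃ w : unitary (H →L[ℂ] H), ρ.Transports W w := by
  obtain ⟨w, hw⟩ := ρ.localizable W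
  exact ⟨w, fun h _ ha => hw _ _ h ⟨_, ha⟩⟩

/-- A region orthogonal to `V` is orthogonal to both `U` and `W`. There `ρ` is the identity and the
transport relation reads `w b = b w`. -/
theorem Transports.mem_vN (hHaag : π₀.HaagDuality) {ρ : Sector π₀ U} {W : C} {w : H →L[ℂ] H}
    (hw : ρ.Transports W w) (f : U ⟶ V) (g : W ⟶ V) : w ∈ π₀.vN V := by
  refine hHaag.mem_vN fun {U' X} f' k h b hb => ?_
  have h1 : P.perp f' (f ≫ k) := by simpa using P.precomp (𝟙 _) f h
  have h2 : P.perp f' (g ≫ k) := by simpa using P.precomp (𝟙 _) g h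
  have := hw h2 (a := π₀.incl U' ⟨b, hb⟩) hb
  rw [ρ.hom_eq_self h1 (a := π₀.incl U' ⟨b, hb⟩) hb] at this
  exact this.symm

theorem Transports.mem_univ [IsFiltered C] (hHaag : π₀.HaagDuality) {ρ : Sector π₀ U} {W : C}
    {w : H →L[ℂ] H} (hw : ρ.Transports W w) : w ∈ π₀.univ :=
  π₀.vN_le_univ _ (hw.mem_vN hHaag (IsFiltered.leftToMax U W) (IsFiltered.rightToMax U W))

/-- Charge transporters as unitaries of the universal algebra. -/
theorem exists_transports_univ [IsFiltered C] (hHaag : π₀.HaagDuality) (ρ : Sector π₀ U) (W : C) :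
    ∃ w : π₀.univ, star w * w = 1 ∧ w * star w = 1 ∧ ρ.Transports W w := by
  obtain ⟨w, hw⟩ := ρ.exists_transports W
  exact ⟨⟨w, hw.mem_univ hHaag⟩, Subtype.ext (Unitary.coe_star_mul_self w),
    Subtype.ext (Unitary.coe_mul_star_self w), hw⟩

/-- Away from the region to which the charge has been moved, the sector is inner; this makes
products of sectors computable. -/
theorem Transports.hom_eq {ρ : Sector π₀ U} {W : C} {w : π₀.univ}
    (hw : ρ.Transports W w) (h1 : star w * w = 1) {W' V : C} {f' : W' ⟶ V} {f : W ⟶ V}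
    (h : P.perp f' f) {a : π₀.univ} (ha : (a : H →L[ℂ] H) ∈ π₀.vN W') :
    ρ.hom a = star w * a * w := by
  have h2 : w * ρ.hom a = a * w := Subtype.ext (hw h ha)
  rw [mul_assoc, ← h2, ← mul_assoc, h1, one_mul]

/-- Sectors localized in orthogonal regions commute. -/
theorem hom_comp_comm [IsFiltered C] (hHaag : π₀.HaagDuality) (hsep : P.HasSeparation)
    {U₁ U₂ V : C} {f₁ : U₁ ⟶ V} {f₂ : U₂ ⟶ V} (h : P.perp f₁ f₂)
    (ρ : Sector π₀ U₁) (σ : Sector π₀ U₂) : Commute ρ.hom σ.hom := by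
  refine univ_hom_ext fun X a ha => ?_
  -- Enlarging the target to contain the region of `a` is harmless, since orthogonality is stable
  -- under postcomposition.
  let Y := IsFiltered.max V X
  have haY : (a : H →L[ℂ] H) ∈ π₀.vN Y := π₀.vN_mono (IsFiltered.rightToMax V X) ha
  obtain ⟨W, V₁, V₂, U₁', U₂', k, a₁, a₂, b₁', b₁, b₂, b₂', ha12, hb1, hb2, hk1, hk2⟩ :=
    hsep _ _ (P.postcomp (IsFiltered.leftToMax V X) h)
  -- Each charge is moved to the auxiliary region `Uᵢ'`, which is orthogonal to `Y` and lies in `Vᵢ`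
  -- together with `Uᵢ`; hence `wᵢ ∈ 𝔐(Vᵢ)`.
  obtain ⟨w₁, hw₁, hw₁', ht₁⟩ := ρ.exists_transports_univ hHaag U₁'
  obtain ⟨w₂, hw₂, hw₂', ht₂⟩ := σ.exists_transports_univ hHaag U₂'
  have hm₁ := ht₁.mem_vN hHaag b₁ b₁'
  have hm₂ := ht₂.mem_vN hHaag b₂ b₂'
  have hρ : ρ.hom a = star w₁ * a * w₁ := ht₁.hom_eq hw₁ (P.symm hk1) haY
  have hσ : σ.hom a = star w₂ * a * w₂ := ht₂.hom_eq hw₂ (P.symm hk2) haY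
  -- `U₁` sits in `V₁`, which is orthogonal to the region `V₂` of `w₂`; symmetrically below.
  have hρw : ρ.hom w₂ = w₂ :=
    ρ.hom_eq_self (P.symm (by simpa using P.precomp b₁ (𝟙 _) ha12)) hm₂
  have hσw : σ.hom w₁ = w₁ :=
    σ.hom_eq_self (by simpa using P.precomp (𝟙 _) b₂ ha12) hm₁
  have hc : w₁ * w₂ = w₂ * w₁ := Subtype.ext (vN_commute ha12 hm₁ hm₂)
  have hcs : star w₁ * star w₂ = star w₂ * star w₁ := by
    rw [← star_mul, ← star_mul, hc]
  change ρ.hom (σ.hom a) = σ.hom (ρ.hom a)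
  rw [hσ, hρ, map_mul, map_mul, map_mul, map_mul, map_star, map_star, hρw, hσw, hρ, hσ]
  calc star w₂ * (star w₁ * a * w₁) * w₂ = (star w₂ * star w₁) * a * (w₁ * w₂) := by
        simp only [mul_assoc]
    _ = star w₁ * (star w₂ * a * w₂) * w₁ := by rw [hc, ← hcs]; simp only [mul_assoc]

/-- Strictness axioms compare morphisms whose endpoints need not agree definitionally. Once the
endpoints are identified, a morphism is its operator, so every such axiom reduces to an equality of
operators. -/
theorem heq_of_op_eq {ρ ρ' σ σ' : Sector π₀ U} (h : ρ = σ) (h' : ρ' = σ') {T : ρ ⟶ ρ'}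
    {S : σ ⟶ σ'} (hTS : op T = op S) : HEq T S := by
  subst h h'
  exact heq_of_eq (Subtype.ext hTS)

theorem heq_of_opUniv_eq {ρ ρ' σ σ' : Sector π₀ U} (h : ρ = σ) (h' : ρ' = σ') {T : ρ ⟶ ρ'}
    {S : σ ⟶ σ'} (hTS : opUniv T = opUniv S) : HEq T S :=
  heq_of_op_eq h h' (congrArg Subtype.val hTS)

theorem hom_ext_univ {ρ ρ' : Sector π₀ U} {T S : ρ ⟶ ρ'} (h : opUniv T = opUniv S) : T = S :=
  Subtype.ext (congrArg (fun a : π₀.univ => (a : H →L[ℂ] H)) h)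

/-- The morphism of sectors given by an intertwining operator. -/
def mkHom {ρ ρ' : Sector π₀ U} (T : H →L[ℂ] H) (hT : T ∈ π₀.vN U)
    (h : ∀ a : π₀.univ, T * (ρ.hom a : H →L[ℂ] H) = (ρ'.hom a : H →L[ℂ] H) * T) : ρ ⟶ ρ' :=
  (⟨T, hT, h⟩ : ρ.homs ρ')

section op

variable {ρ ρ' ρ'' : Sector π₀ U}

theorem op_intertwines (T : ρ ⟶ ρ') (a : π₀.univ) :
    op T * (ρ.hom a : H →L[ℂ] H) = (ρ'.hom a : H →L[ℂ] H) * op T := (T : ρ.homs ρ').2.2 a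

@[simp] theorem hom_extend (f : U ⟶ V) : (extend f ρ).hom = ρ.hom := rfl
@[simp] theorem opUniv_id : opUniv (𝟙 ρ) = 1 := rfl
@[simp] theorem opUniv_comp (T : ρ ⟶ ρ') (S : ρ' ⟶ ρ'') :
    opUniv (T ≫ S) = opUniv S * opUniv T := rfl
@[simp] theorem opUniv_add (T S : ρ ⟶ ρ') : opUniv (T + S) = opUniv T + opUniv S := rfl
@[simp] theorem opUniv_smul (c : ℂ) (T : ρ ⟶ ρ') : opUniv (c • T) = c • opUniv T := rfl
@[simp] theorem opUniv_adj (T : ρ ⟶ ρ') : opUniv (adj T) = star (opUniv T) := rfl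
@[simp] theorem opUniv_extendHom (f : U ⟶ V) (T : ρ ⟶ ρ') : opUniv (extendHom f T) = opUniv T := rfl

theorem opUniv_intertwines (T : ρ ⟶ ρ') (a : π₀.univ) :
    opUniv T * ρ.hom a = ρ'.hom a * opUniv T := Subtype.ext (op_intertwines T a)

end op

/-! ### The strict monoidal structure -/

/-- The vacuum sector. -/
def vacuum (π₀ : A.Representation H) (U : C) : Sector π₀ U where
  hom := 1
  localizable _ := ⟨1, fun _ _ _ _ => (one_mul _).trans (mul_one _).symm⟩
  localized _ _ _ _ := rfl

/-- The composition of sectors as endomorphisms. -/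
def comp [IsFiltered C] (hHaag : π₀.HaagDuality) (ρ σ : Sector π₀ U) : Sector π₀ U where
  hom := ρ.hom * σ.hom
  localizable W := by
    obtain ⟨r, hr, hr', htr⟩ := ρ.exists_transports_univ hHaag W
    obtain ⟨s, hs, hs', hts⟩ := σ.exists_transports_univ hHaag W
    -- The transporter of `ρσ` is `r ρ(s)`: `ρ` carries `s σ(a) = a s` to `ρ(s) ρσ(a) = ρ(a) ρ(s)`,
    -- and `r` then removes `ρ`. This needs `s` to lie in the universal algebra.
    have h1 : star (r * ρ.hom s) * (r * ρ.hom s) = 1 := by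
      rw [star_mul, mul_assoc, ← mul_assoc (star r), hr, one_mul, ← map_star, ← map_mul, hs, map_one]
    have h2 : (r * ρ.hom s) * star (r * ρ.hom s) = 1 := by
      rw [star_mul, mul_assoc, ← mul_assoc (ρ.hom s), ← map_star, ← map_mul, hs', map_one,
        one_mul, hr']
    refine ⟨⟨(r * ρ.hom s : π₀.univ), Unitary.mem_iff.2
      ⟨congrArg Subtype.val h1, congrArg Subtype.val h2⟩⟩, ?_⟩
    intro W' V f' f h a
    have hσ : s * σ.hom (π₀.incl W' a) = π₀.incl W' a * s := Subtype.ext (hts h a.2)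
    have hρ : r * ρ.hom (π₀.incl W' a) = π₀.incl W' a * r := Subtype.ext (htr h a.2)
    have key : r * ρ.hom s * ρ.hom (σ.hom (π₀.incl W' a)) =
        π₀.incl W' a * (r * ρ.hom s) := by
      rw [mul_assoc, ← map_mul, hσ, map_mul, ← mul_assoc, hρ, mul_assoc]
    exact congrArg Subtype.val key
  localized {U' V} f' f h a := by
    change ρ.hom (σ.hom _) = _
    rw [σ.localized f' f h, ρ.localized f' f h]

/-- The product `T ◇ S = T ρ(S)` of morphisms of sectors. -/
def compHom [IsFiltered C] (hHaag : π₀.HaagDuality) {ρ ρ' σ σ' : Sector π₀ U} (T : ρ ⟶ ρ')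
    (S : σ ⟶ σ') : comp hHaag ρ σ ⟶ comp hHaag ρ' σ' :=
  mkHom (op T * (ρ.hom (opUniv S) : H →L[ℂ] H))
    (mul_mem (op_mem T) (ρ.hom_mem_vN hHaag (op_mem S))) fun a => by
      have : opUniv T * ρ.hom (opUniv S) * ρ.hom (σ.hom a) =
          ρ'.hom (σ'.hom a) * (opUniv T * ρ.hom (opUniv S)) := by
        rw [mul_assoc, ← map_mul, opUniv_intertwines S, map_mul, ← mul_assoc, opUniv_intertwines T,
          mul_assoc]
      exact congrArg Subtype.val this

@[simp] theorem hom_vacuum : (vacuum π₀ U).hom = 1 := rfl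

section comp

variable [IsFiltered C] (hHaag : π₀.HaagDuality) {ρ ρ' σ σ' : Sector π₀ U}

@[simp] theorem hom_comp : (comp hHaag ρ σ).hom = ρ.hom * σ.hom := rfl

@[simp] theorem opUniv_compHom (T : ρ ⟶ ρ') (S : σ ⟶ σ') :
    opUniv (compHom hHaag T S) = opUniv T * ρ.hom (opUniv S) := rfl

end comp

@[simp] theorem univ_hom_mul_apply (φ ψ : π₀.univ →⋆ₐ[ℂ] π₀.univ) (a : π₀.univ) :
    (φ * ψ) a = φ (ψ a) := rfl

@[simp] theorem univ_hom_one_apply (a : π₀.univ) : (1 : π₀.univ →⋆ₐ[ℂ] π₀.univ) a = a := rfl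

/-- The strict monoidal structure on the sectors localized in a region. -/
def monoidal [IsFiltered C] (hHaag : π₀.HaagDuality) (U : C) : StrictMonoidal (Sector π₀ U) where
  unit := vacuum π₀ U
  tensorObj := comp hHaag
  tensorHom := compHom hHaag
  tensor_id X Y := hom_ext_univ (by simp)
  tensor_comp {X X' X'' Y Y' Y''} S S' T T' := hom_ext_univ (by
    simp only [opUniv_compHom, opUniv_comp]
    -- The exchange law is the intertwining relation `S X(T') = X'(T') S`, with `T'` in the role of
    -- an observable.
    rw [map_mul, mul_assoc, ← mul_assoc (opUniv S), opUniv_intertwines S]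
    simp only [mul_assoc])
  add_tensor S S' T := hom_ext_univ (by simp [add_mul])
  tensor_add S T T' := hom_ext_univ (by simp [mul_add])
  smul_tensor c S T := hom_ext_univ (by simp)
  tensor_smul c S T := hom_ext_univ (by simp)
  tensor_adj {X X' Y Y'} S T := hom_ext_univ (by
    rw [opUniv_compHom, opUniv_intertwines, opUniv_adj, opUniv_adj, opUniv_adj, opUniv_compHom,
      star_mul, map_star])
  assoc_obj X Y Z := rfl
  assoc_hom {X X' Y Y' Z Z'} R S T := heq_of_opUniv_eq rfl rfl (by
    change opUniv R * X.hom (opUniv S) * X.hom (Y.hom (opUniv T)) =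
      opUniv R * X.hom (opUniv S * Y.hom (opUniv T))
    rw [map_mul, mul_assoc])
  unit_tensor_obj X := rfl
  unit_tensor_hom T := heq_of_opUniv_eq rfl rfl (one_mul (opUniv T))
  tensor_unit_obj X := rfl
  tensor_unit_hom {X X'} T := heq_of_opUniv_eq rfl rfl (by
    change opUniv T * X.hom 1 = opUniv T
    rw [map_one, mul_one])

end Sector

end Hilbert

end

end Superselection

/-! ### Ordered products of commuting families in a monoid -/

namespace Superselection

noncomputable section

section OrderedProducts

variable {M : Type u₁} [Monoid M]

theorem Commute.list_prod_ofFn {n : ℕ} {x : Fin n → M} {y : M} (h : ∀ i, Commute y (x i)) :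
    Commute y (List.ofFn x).prod := by
  refine Commute.list_prod_right _ _ fun z hz => ?_
  obtain ⟨i, rfl⟩ := (List.mem_ofFn' _ _).1 hz
  exact h i

/-- Sorting moves each `y i` only past `x j` with `j > i`, so no commutation is needed between
factors of equal index. This is what makes factorization products compatible with the noncommutative
product `◇`. -/
theorem list_prod_ofFn_mul {n : ℕ} {x y : Fin n → M} (h : ∀ i j, i ≠ j → Commute (x i) (y j)) :
    (List.ofFn fun i => x i * y i).prod = (List.ofFn x).prod * (List.ofFn y).prod := by
  induction n with
  | zero => simp
  | succ n ih =>
    have hc : Commute (y 0) (List.ofFn fun i : Fin n => x i.succ).prod :=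
      Commute.list_prod_ofFn fun i => (h i.succ 0 (Fin.succ_ne_zero i)).symm
    simp only [List.ofFn_succ, List.prod_cons]
    rw [ih fun i j hij => h _ _ fun e => hij (Fin.succ_injective _ e)]
    calc x 0 * y 0 * ((List.ofFn fun i : Fin n => x i.succ).prod * _)
        = x 0 * (y 0 * (List.ofFn fun i : Fin n => x i.succ).prod) *
            (List.ofFn fun i : Fin n => y i.succ).prod := by simp only [mul_assoc]
      _ = _ := by rw [hc.eq]; simp only [mul_assoc]

theorem star_list_prod_ofFn [StarMul M] {n : ℕ} {x : Fin n → M}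
    (h : ∀ i j, i ≠ j → Commute (x i) (x j)) :
    star (List.ofFn x).prod = (List.ofFn fun i => star (x i)).prod := by
  induction n with
  | zero => simp
  | succ n ih =>
    have hc : Commute (x 0) (List.ofFn fun i : Fin n => x i.succ).prod :=
      Commute.list_prod_ofFn fun i => h 0 i.succ (Fin.succ_ne_zero i).symm
    simp only [List.ofFn_succ, List.prod_cons]
    rw [hc.eq, star_mul, ih fun i j hij => h _ _ fun e => hij (Fin.succ_injective _ e)]

theorem map_list_prod_ofFn {N F : Type*} [Monoid N] [FunLike F M N] [MonoidHomClass F M N] (φ : F)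
    {n : ℕ} (x : Fin n → M) : φ (List.ofFn x).prod = (List.ofFn fun i => φ (x i)).prod := by
  rw [map_list_prod, List.map_ofFn]
  rfl

/-- A pairwise commuting family is the image of a family in a commutative monoid. -/
theorem exists_commMonoid_of_commute {ι : Type*} {x : ι → M}
    (h : ∀ i j, i ≠ j → Commute (x i) (x j)) :
    ∃ (S : Type u₁) (_ : CommMonoid S) (φ : S →* M) (y : ι → S), ∀ i, φ (y i) = x i := by
  have hS : IsMulCommutative (Submonoid.closure (Set.range x)) := by
    refine Submonoid.isMulCommutative_closure _ ?_
    rintro _ ⟨i, rfl⟩ _ ⟨j, rfl⟩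
    by_cases hij : i = j
    · rw [hij]
    · exact h i j hij
  exact ⟨Submonoid.closure (Set.range x),
    { (inferInstance : Monoid (Submonoid.closure (Set.range x))) with
      mul_comm := hS.is_comm.comm },
    (Submonoid.closure (Set.range x)).subtype,
    fun i => ⟨x i, Submonoid.subset_closure ⟨i, rfl⟩⟩, fun i => rfl⟩

/-- After passing to the commutative submonoid generated by the family, the ordered product is an
ordinary finite product. -/
theorem list_prod_ofFn_perm {n : ℕ} {x : Fin n → M} (h : ∀ i j, i ≠ j → Commute (x i) (x j))
    (σ : Equiv.Perm (Fin n)) : (List.ofFn fun i => x (σ i)).prod = (List.ofFn x).prod := by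
  obtain ⟨S, hS, φ, y, hy⟩ := exists_commMonoid_of_commute h
  obtain rfl : x = fun i => φ (y i) := funext fun i => (hy i).symm
  rw [← map_list_prod_ofFn φ, ← map_list_prod_ofFn φ]
  rw [List.prod_ofFn, List.prod_ofFn, Equiv.prod_comp]

theorem list_prod_ofFn_sigma {n : ℕ} {k : Fin n → ℕ} {x : ∀ i, Fin (k i) → M}
    (h : ∀ p q : (i : Fin n) × Fin (k i), p ≠ q → Commute (x p.1 p.2) (x q.1 q.2)) :
    (List.ofFn fun j : Fin (∑ i, k i) =>
      x (finSigmaFinEquiv.symm j).1 (finSigmaFinEquiv.symm j).2).prod =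
      (List.ofFn fun i => (List.ofFn (x i)).prod).prod := by
  obtain ⟨S, hS, φ, y, hy⟩ := exists_commMonoid_of_commute
    (x := fun p : (i : Fin n) × Fin (k i) => x p.1 p.2) h
  have hy' : ∀ i l, x i l = φ (y ⟨i, l⟩) := fun i l => (hy ⟨i, l⟩).symm
  have hx : x = fun i l => φ (y ⟨i, l⟩) := funext fun i => funext fun l => hy' i l
  subst hx
  simp only [← map_list_prod_ofFn φ, List.prod_ofFn]
  rw [← Fintype.prod_sigma' fun i l => y ⟨i, l⟩, ← Equiv.prod_comp finSigmaFinEquiv.symm]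

end OrderedProducts

end

end Superselection

/-! ### Factorization products and the prefactorization algebra -/

namespace Superselection

noncomputable section

open CStarCategory

section Hilbert

variable {C : Type u} [Category.{v} C] {P : Orthogonality C}
  {H : Type w'} [NormedAddCommGroup H] [InnerProductSpace ℂ H] [CompleteSpace H]
  {A : AQFT.{v, u, w} P} {π₀ : A.Representation H}

open AQFT.Representation

namespace Sector

theorem opUniv_commute {U₁ U₂ V : C} {f₁ : U₁ ⟶ V} {f₂ : U₂ ⟶ V} (h : P.perp f₁ f₂)
    {a b : π₀.univ} (ha : (a : H →L[ℂ] H) ∈ π₀.vN U₁) (hb : (b : H →L[ℂ] H) ∈ π₀.vN U₂) :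
    Commute a b :=
  Subtype.ext (vN_commute h ha hb)

theorem opUniv_commute_of_ne {n : ℕ} {U : Fin n → C} {V : C} (f : P.Op U V)
    {X Y X' Y' : ∀ i, Sector π₀ (U i)} (T : ∀ i, X i ⟶ Y i) (S : ∀ i, X' i ⟶ Y' i)
    {i j : Fin n} (h : i ≠ j) : Commute (opUniv (T i)) (opUniv (S j)) :=
  opUniv_commute (f.2 i j h) (op_mem _) (op_mem _)

/-- Morphisms are local operators, and `ρ i` is the identity on regions orthogonal to its own; this
is what untwists `T ρ(S)`. -/
theorem hom_opUniv_of_ne {n : ℕ} {U : Fin n → C} {V : C} (f : P.Op U V)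
    {X Y : ∀ i, Sector π₀ (U i)} (T : ∀ i, X i ⟶ Y i) (ρ : ∀ i, Sector π₀ (U i))
    {i j : Fin n} (h : i ≠ j) : (ρ i).hom (opUniv (T j)) = opUniv (T j) :=
  (ρ i).hom_eq_self (f.2 j i h.symm) (op_mem _)

/-- The value of a product of sectors on an observable localized in one of the regions. -/
theorem list_prod_hom_apply (hHaag : π₀.HaagDuality) {n : ℕ} {U : Fin n → C} {V : C} (f : P.Op U V)
    (X : ∀ i, Sector π₀ (U i)) (j : Fin n) {a : π₀.univ} (ha : (a : H →L[ℂ] H) ∈ π₀.vN (U j)) :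
    (List.ofFn fun i => (X i).hom).prod a = (X j).hom a := by
  have hfix : ∀ (m : ℕ) (φ : Fin m → π₀.univ →⋆ₐ[ℂ] π₀.univ) (b : π₀.univ),
      (∀ i, φ i b = b) → (List.ofFn φ).prod b = b := by
    intro m
    induction m with
    | zero => intro φ b _; rfl
    | succ m ih =>
      intro φ b h
      simp only [List.ofFn_succ, List.prod_cons, univ_hom_mul_apply]
      rw [ih _ _ fun i => h i.succ, h 0]
  induction n with
  | zero => exact j.elim0
  | succ n ih =>
    let f' : P.Op (fun i : Fin n => U i.succ) V :=
      ⟨fun i => f.1 i.succ, fun i j hij => f.2 _ _ fun e => hij (Fin.succ_injective _ e)⟩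
    simp only [List.ofFn_succ, List.prod_cons, univ_hom_mul_apply]
    refine Fin.cases (fun ha => ?_) (fun j ha => ?_) j ha
    · rw [hfix _ _ _ fun i => (X i.succ).hom_eq_self (f.2 0 i.succ (Fin.succ_ne_zero i).symm) ha]
    · rw [ih f' (fun i => X i.succ) j ha]
      -- The value of the later sector is still localized in its own region by Haag duality, so `X
      -- 0` fixes it.
      exact (X 0).hom_eq_self (f.2 j.succ 0 (Fin.succ_ne_zero j)) ((X j.succ).hom_mem_vN hHaag ha)

section Products

variable [IsFiltered C] (hHaag : π₀.HaagDuality)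

@[simp] theorem monoidal_unit (U : C) : (monoidal hHaag U).unit = vacuum π₀ U := rfl

@[simp] theorem monoidal_tensorObj {U : C} (ρ σ : Sector π₀ U) :
    (monoidal hHaag U).tensorObj ρ σ = comp hHaag ρ σ := rfl

@[simp] theorem monoidal_tensorHom {U : C} {ρ ρ' σ σ' : Sector π₀ U} (T : ρ ⟶ ρ') (S : σ ⟶ σ') :
    (monoidal hHaag U).tensorHom T S = compHom hHaag T S := rfl

theorem hom_prodObj {U : C} {n : ℕ} (X : Fin n → Sector π₀ U) :
    ((monoidal hHaag U).prodObj X).hom = (List.ofFn fun i => (X i).hom).prod := by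
  induction n with
  | zero => rfl
  | succ n ih =>
    simp only [List.ofFn_succ, List.prod_cons]
    rw [← ih]
    rfl

theorem opUniv_prodHom {U : C} {n : ℕ} {X Y : Fin n → Sector π₀ U} (T : ∀ i, X i ⟶ Y i)
    (h : ∀ i j, i ≠ j → (X i).hom (opUniv (T j)) = opUniv (T j)) :
    opUniv ((monoidal hHaag U).prodHom T) = (List.ofFn fun i => opUniv (T i)).prod := by
  induction n with
  | zero => rfl
  | succ n ih =>
    simp only [List.ofFn_succ, List.prod_cons]
    have ih' := ih (fun i => T i.succ) fun i j hij => h _ _ fun e => hij (Fin.succ_injective _ e)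
    change opUniv (T 0) * (X 0).hom (opUniv ((monoidal hHaag U).prodHom fun i => T i.succ)) = _
    rw [ih', map_list_prod_ofFn]
    congr 3
    ext1 i
    exact h 0 i.succ (Fin.succ_ne_zero i).symm

variable {n : ℕ} {U : Fin n → C} {V : C} (f : P.Op U V)

theorem opUniv_factorization {X Y : ∀ i, Sector π₀ (U i)} (T : ∀ i, X i ⟶ Y i) :
    opUniv ((monoidal hHaag V).prodHom fun i => extendHom (f.1 i) (T i)) =
      (List.ofFn fun i => opUniv (T i)).prod := by
  refine opUniv_prodHom hHaag (fun i => extendHom (f.1 i) (T i)) fun i j h => ?_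
  rw [opUniv_extendHom, hom_extend]
  exact hom_opUniv_of_ne f T X h

/-- The factorization products: include all inputs into the sectors over the target, then
multiply. -/
def factorization : MultiStarFunctor (fun i => Sector π₀ (U i)) (Sector π₀ V) where
  obj ρ := (monoidal hHaag V).prodObj fun i => extend (f.1 i) (ρ i)
  map T := (monoidal hHaag V).prodHom fun i => extendHom (f.1 i) (T i)
  map_id X := hom_ext_univ (by
    rw [opUniv_factorization]
    simp)
  map_comp S T := hom_ext_univ (by
    rw [opUniv_comp, opUniv_factorization, opUniv_factorization, opUniv_factorization,
      ← list_prod_ofFn_mul fun i j h => opUniv_commute_of_ne f T S h]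
    rfl)
  map_add T i S S' := hom_ext_univ (by
    rw [opUniv_add, opUniv_factorization, opUniv_factorization, opUniv_factorization]
    have h := (MultilinearMap.mkPiAlgebraFin ℂ n π₀.univ).map_update_add
      (fun j => opUniv (T j)) i (opUniv S) (opUniv S')
    simp only [MultilinearMap.mkPiAlgebraFin_apply] at h
    simp only [Function.apply_update (fun _ => opUniv), opUniv_add]
    exact h)
  map_smul T i c S := hom_ext_univ (by
    rw [opUniv_smul, opUniv_factorization, opUniv_factorization]
    have h := (MultilinearMap.mkPiAlgebraFin ℂ n π₀.univ).map_update_smul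
      (fun j => opUniv (T j)) i c (opUniv S)
    simp only [MultilinearMap.mkPiAlgebraFin_apply] at h
    simp only [Function.apply_update (fun _ => opUniv), opUniv_smul]
    exact h)
  map_adj T := hom_ext_univ (by
    rw [opUniv_adj, opUniv_factorization, opUniv_factorization,
      star_list_prod_ofFn fun i j h => opUniv_commute_of_ne f T T h]
    rfl)

@[simp] theorem hom_factorization_obj (X : ∀ i, Sector π₀ (U i)) :
    ((factorization hHaag f).obj X).hom = (List.ofFn fun i => (X i).hom).prod :=
  hom_prodObj hHaag _

@[simp] theorem opUniv_factorization_map {X Y : ∀ i, Sector π₀ (U i)} (T : ∀ i, X i ⟶ Y i) :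
    opUniv ((factorization hHaag f).map T) = (List.ofFn fun i => opUniv (T i)).prod :=
  opUniv_factorization hHaag f T

/-- On objects this is the interchange `∏ ρᵢσᵢ = ∏ ρᵢ ∏ σᵢ`, where separation enters through the
commutation of `ρᵢ` with `σⱼ` for `i ≠ j`. On morphisms, the product of all `Xᵢ` acts on `Tⱼ` as
`Xⱼ` alone, and operators of distinct regions commute. -/
theorem factorization_isStrictMonoidal (hsep : P.HasSeparation) :
    (factorization hHaag f).IsStrictMonoidal (fun i => monoidal (π₀ := π₀) hHaag (U i))
      (monoidal hHaag V) := by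
  have hobj : ∀ X Y : ∀ i, Sector π₀ (U i), (factorization hHaag f).obj
      (fun i => comp hHaag (X i) (Y i)) =
      comp hHaag ((factorization hHaag f).obj X) ((factorization hHaag f).obj Y) := fun X Y =>
    Sector.ext (by
      rw [hom_comp, hom_factorization_obj, hom_factorization_obj, hom_factorization_obj,
        ← list_prod_ofFn_mul fun i j h => hom_comp_comm hHaag hsep (f.2 i j h) (X i) (Y j)]
      rfl)
  refine ⟨?_, hobj, fun {X X' Y Y'} S T => heq_of_opUniv_eq (hobj X Y) (hobj X' Y') ?_⟩
  · refine Sector.ext ?_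
    rw [hom_factorization_obj]
    simp
  · refine (opUniv_factorization_map hHaag f fun i => compHom hHaag (S i) (T i)).trans ?_
    rw [monoidal_tensorHom, opUniv_compHom, opUniv_factorization_map, opUniv_factorization_map, map_list_prod_ofFn, hom_factorization_obj]
    have h : ∀ i, (List.ofFn fun i => (X i).hom).prod (opUniv (T i)) = (X i).hom (opUniv (T i)) :=
      fun i => list_prod_hom_apply hHaag f X i (op_mem _)
    simp only [h]
    rw [← list_prod_ofFn_mul fun i j hij => opUniv_commute (f.2 i j hij) (op_mem _)
      ((X j).hom_mem_vN hHaag (op_mem _))]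
    rfl

/-- The prefactorization algebra of superselection sectors. -/
def pfa (hsep : P.HasSeparation) : PFA P (fun U => Sector π₀ U) :=
  have id_obj : ∀ (V : C) (X : Fin 1 → Sector π₀ V),
      (factorization hHaag (Orthogonality.unary (P := P) (𝟙 V))).obj X = X 0 := fun V X =>
    Sector.ext (by rw [hom_factorization_obj]; simp)
  have comp_obj : ∀ {n : ℕ} {U : Fin n → C} {V : C} (f : P.Op U V) {k : Fin n → ℕ}
      {W : ∀ i, Fin (k i) → C} (g : ∀ i, P.Op (W i) (U i)) (X : ∀ i l, Sector π₀ (W i l)),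
      (factorization hHaag (f.comp g)).obj
        (fun j => X (finSigmaFinEquiv.symm j).1 (finSigmaFinEquiv.symm j).2) =
      (factorization hHaag f).obj (fun i => (factorization hHaag (g i)).obj (X i)) :=
    fun {n U V} f {k W} g X => Sector.ext (by
      simp only [hom_factorization_obj]
      refine list_prod_ofFn_sigma (x := fun i l => (X i l).hom) fun p q hpq => ?_
      have hp := (f.comp g).2 (finSigmaFinEquiv p) (finSigmaFinEquiv q)
        fun e => hpq (finSigmaFinEquiv.injective e)
      -- Stated for arbitrary pairs so that the round trip through `finSigmaFinEquiv` can afterwards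
      -- be rewritten despite the dependent types.
      have key : ∀ p' q' : (i : Fin n) × Fin (k i), P.perp
          ((g p'.1).1 p'.2 ≫ f.1 p'.1) ((g q'.1).1 q'.2 ≫ f.1 q'.1) →
          Commute (X p'.1 p'.2).hom (X q'.1 q'.2).hom := fun p' q' h =>
        hom_comp_comm hHaag hsep h _ _
      have := key _ _ hp
      rwa [Equiv.symm_apply_apply, Equiv.symm_apply_apply] at this)
  have perm_obj : ∀ {n : ℕ} {U : Fin n → C} {V : C} (f : P.Op U V) (σ : Equiv.Perm (Fin n))
      (X : ∀ i, Sector π₀ (U i)), (factorization hHaag f).obj X =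
        (factorization hHaag (f.perm σ)).obj (fun i => X (σ i)) := fun f σ X =>
    Sector.ext (by
      rw [hom_factorization_obj, hom_factorization_obj]
      exact (list_prod_ofFn_perm (x := fun i => (X i).hom)
        (fun i j h => hom_comp_comm hHaag hsep (f.2 i j h) _ _) σ).symm)
  { mon := monoidal hHaag
    prod := factorization hHaag
    prod_strictMonoidal := fun f => factorization_isStrictMonoidal hHaag f hsep
    id_obj := id_obj
    id_map := fun V {X Y} T => heq_of_opUniv_eq (id_obj V X) (id_obj V Y) (by
      rw [opUniv_factorization_map]; simp)
    comp_obj := comp_obj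
    comp_map := fun {n U V} f {k W} g {X Y} T =>
      heq_of_opUniv_eq (comp_obj f g X) (comp_obj f g Y) (by
        simp only [opUniv_factorization_map]
        refine list_prod_ofFn_sigma (x := fun i l => opUniv (T i l)) fun p q hpq => ?_
        have hp := (f.comp g).2 (finSigmaFinEquiv p) (finSigmaFinEquiv q)
          fun e => hpq (finSigmaFinEquiv.injective e)
        have key : ∀ p' q' : (i : Fin n) × Fin (k i), P.perp
            ((g p'.1).1 p'.2 ≫ f.1 p'.1) ((g q'.1).1 q'.2 ≫ f.1 q'.1) →
            Commute (opUniv (T p'.1 p'.2)) (opUniv (T q'.1 q'.2)) := fun p' q' h =>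
          opUniv_commute h (op_mem _) (op_mem _)
        have := key _ _ hp
        rwa [Equiv.symm_apply_apply, Equiv.symm_apply_apply] at this)
    perm_obj := perm_obj
    perm_map := fun {n U V} f σ {X Y} T =>
      heq_of_opUniv_eq (perm_obj f σ X) (perm_obj f σ Y) (by
        rw [opUniv_factorization_map, opUniv_factorization_map]
        exact (list_prod_ofFn_perm (x := fun i => opUniv (T i))
          (fun i j h => opUniv_commute_of_ne f T T h) σ).symm) }

end Products

end Sector

end Hilbert

end

end Superselection

/-! ### The group action on sectors -/

namespace Superselection

noncomputable section

open CStarCategory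

/-- Adjacent factors `b a` cancel; `a b = 1` serves the empty product. -/
theorem list_prod_ofFn_conj {M : Type*} [Monoid M] {a b : M} (hab : a * b = 1) (hba : b * a = 1)
    {n : ℕ} (x : Fin n → M) :
    (List.ofFn fun i => a * (x i * b)).prod = a * ((List.ofFn x).prod * b) := by
  induction n with
  | zero => simp [hab]
  | succ n ih =>
    simp only [List.ofFn_succ, List.prod_cons]
    rw [ih fun i => x i.succ]
    calc a * (x 0 * b) * (a * ((List.ofFn fun i : Fin n => x i.succ).prod * b))
        = a * x 0 * (b * a) * ((List.ofFn fun i : Fin n => x i.succ).prod * b) := by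
          simp only [mul_assoc]
      _ = _ := by rw [hba, mul_one]; simp only [mul_assoc]

section Hilbert

variable {C : Type u} [Category.{v} C] {P : Orthogonality C}
  {H : Type w'} [NormedAddCommGroup H] [InnerProductSpace ℂ H] [CompleteSpace H]
  {A : AQFT.{v, u, w} P} {π₀ : A.Representation H}

open AQFT.Representation

namespace Implementation

variable {G : Type*} [Group G] {α : P.GroupAction G} {Ψ : A.Equivariance α}
  (u : Implementation Ψ π₀)

theorem ad_mul (g h : G) : u.ad (g * h) = u.ad g * u.ad h := by
  ext a
  simp

theorem ad_one : u.ad 1 = 1 := by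
  ext a
  simp

theorem ad_mul_ad_inv (g : G) : u.ad g * u.ad g⁻¹ = 1 := by
  rw [← ad_mul, mul_inv_cancel, ad_one]

theorem ad_inv_mul_ad (g : G) : u.ad g⁻¹ * u.ad g = 1 := by
  rw [← ad_mul, inv_mul_cancel, ad_one]

theorem ad_ad_inv (g : G) (a : π₀.univ) : u.ad g (u.ad g⁻¹ a) = a :=
  DFunLike.congr_fun (u.ad_mul_ad_inv g) a

theorem ad_inv_ad (g : G) (a : π₀.univ) : u.ad g⁻¹ (u.ad g a) = a :=
  DFunLike.congr_fun (u.ad_inv_mul_ad g) a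

theorem Ad_ad_inv (g : G) (a : π₀.univ) :
    Ad H (u.u g) (u.ad g⁻¹ a : H →L[ℂ] H) = (a : H →L[ℂ] H) := by
  rw [← u.coe_ad, ad_ad_inv]

/-- Strictness gives `U = α_{g⁻¹}(α_g(U))`, so regions orthogonal to `α_g(U)` pull back to regions
orthogonal to `U`. -/
theorem perp_act {U U' V : C} (g : G) {f' : U' ⟶ V} {f : α.obj g U ⟶ V} (h : P.perp f' f) :
    ∃ k : U ⟶ α.obj g⁻¹ V, P.perp ((α.functor g⁻¹).map f') k := by
  have e : U = α.obj g⁻¹ (α.obj g U) := by rw [← α.obj_mul, inv_mul_cancel, α.obj_one]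
  refine ⟨eqToHom e ≫ (α.functor g⁻¹).map f, ?_⟩
  have := P.precomp (𝟙 _) (eqToHom e) (α.map_perp g⁻¹ h)
  rwa [Category.id_comp] at this

/-- The translate `g ▷ ρ = Ad_{u_g} ρ Ad_{u_g}⁻¹` of a sector. -/
def translate (g : G) {U : C} (ρ : Sector π₀ U) : Sector π₀ (α.obj g U) where
  hom := u.ad g * (ρ.hom * u.ad g⁻¹)
  localizable W := by
    -- A transporter of `g ▷ ρ` to `W` is the translate of a transporter of `ρ` to `α_{g⁻¹}(W)`.
    obtain ⟨w, hw⟩ := ρ.exists_transports (α.obj g⁻¹ W)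
    refine ⟨⟨Ad H (u.u g) w, Unitary.map_mem (Ad H (u.u g)) w.2⟩, fun {W' V} f' f h a => ?_⟩
    have h1 := congrArg (Ad H (u.u g)) (hw (α.map_perp g⁻¹ h) (a := u.ad g⁻¹ (π₀.incl W' a))
      (u.Ad_mem_vN g⁻¹ W' a.2))
    rw [map_mul, map_mul, Ad_ad_inv] at h1
    exact h1
  localized {U' V} f' f h a := by
    obtain ⟨k, hk⟩ := perp_act g h
    change u.ad g (ρ.hom (u.ad g⁻¹ (π₀.incl U' a))) = _
    rw [ρ.hom_eq_self hk (a := u.ad g⁻¹ (π₀.incl U' a)) (u.Ad_mem_vN g⁻¹ U' a.2), ad_ad_inv]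

@[simp] theorem hom_translate (g : G) {U : C} (ρ : Sector π₀ U) :
    (u.translate g ρ).hom = u.ad g * (ρ.hom * u.ad g⁻¹) := rfl

/-- The translate `g ▷ T = Ad_{u_g}(T)` of a morphism of sectors. -/
def translateHom (g : G) {U : C} {ρ ρ' : Sector π₀ U} (T : ρ ⟶ ρ') :
    u.translate g ρ ⟶ u.translate g ρ' :=
  Sector.mkHom (Ad H (u.u g) (Sector.op T)) (u.Ad_mem_vN g U (Sector.op_mem T)) fun a => by
    have := congrArg (u.ad g) (Sector.opUniv_intertwines T (u.ad g⁻¹ a))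
    rw [map_mul, map_mul] at this
    exact congrArg Subtype.val this

@[simp] theorem opUniv_translateHom (g : G) {U : C} {ρ ρ' : Sector π₀ U} (T : ρ ⟶ ρ') :
    Sector.opUniv (u.translateHom g T) = u.ad g (Sector.opUniv T) := rfl

/-- The translation functors between sectors. -/
def act (g : G) (U : C) : StarFunctor (Sector π₀ U) (Sector π₀ (α.obj g U)) where
  obj := u.translate g
  map := u.translateHom g
  map_id X := Sector.hom_ext_univ (by simp)
  map_comp S T := Sector.hom_ext_univ (by simp)
  map_add S T := Sector.hom_ext_univ (by simp)
  map_smul c T := Sector.hom_ext_univ (by simp)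
  map_adj T := Sector.hom_ext_univ (by simp [map_star])

variable [IsFiltered C] (hHaag : π₀.HaagDuality)

theorem act_isStrictMonoidal (g : G) (U : C) : (u.act g U).IsStrictMonoidal
    (Sector.monoidal hHaag U) (Sector.monoidal hHaag (α.obj g U)) := by
  have hobj : ∀ X Y : Sector π₀ U, u.translate g (Sector.comp hHaag X Y) =
      Sector.comp hHaag (u.translate g X) (u.translate g Y) := fun X Y => Sector.ext (by
    ext a
    simp [ad_inv_ad])
  refine ⟨Sector.ext ?_, hobj, fun {X X' Y Y'} S T =>
    Sector.heq_of_opUniv_eq (hobj X Y) (hobj X' Y') ?_⟩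
  · change u.ad g * (1 * u.ad g⁻¹) = 1
    rw [one_mul, ad_mul_ad_inv]
  · change u.ad g (Sector.opUniv S * X.hom (Sector.opUniv T)) = u.ad g (Sector.opUniv S) *
      u.ad g (X.hom (u.ad g⁻¹ (u.ad g (Sector.opUniv T))))
    rw [map_mul, ad_inv_ad]

open Sector in
/-- The equivariant prefactorization algebra of superselection sectors. -/
def equivariantPFA (hsep : P.HasSeparation) : EquivariantPFA α (fun U => Sector π₀ U) :=
  have act_prod_obj : ∀ (g : G) {n : ℕ} {U : Fin n → C} {V : C} (f : P.Op U V)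
      (X : ∀ i, Sector π₀ (U i)), u.translate g ((factorization hHaag f).obj X) =
        (factorization hHaag (α.mapOp g f)).obj (fun i => u.translate g (X i)) :=
    fun g {n U V} f X => Sector.ext (by
      rw [hom_translate, hom_factorization_obj, hom_factorization_obj]
      exact (list_prod_ofFn_conj (u.ad_mul_ad_inv g) (u.ad_inv_mul_ad g) _).symm)
  have act_one_obj : ∀ (U : C) (X : Sector π₀ U),
      (factorization hHaag (Orthogonality.unary (P := P) (eqToHom (α.obj_one U)))).obj
        (fun _ => u.translate 1 X) = X := fun U X => Sector.ext (by
    rw [hom_factorization_obj]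
    simp [ad_one])
  have act_mul_obj : ∀ (g' g : G) (U : C) (X : Sector π₀ U),
      (factorization hHaag (Orthogonality.unary (P := P) (eqToHom (α.obj_mul g' g U)))).obj
        (fun _ => u.translate (g' * g) X) = u.translate g' (u.translate g X) := fun g' g U X =>
    Sector.ext (by
      rw [hom_factorization_obj]
      simp [ad_mul, mul_assoc])
  { pfa hHaag hsep with
    act := u.act
    act_strictMonoidal := u.act_isStrictMonoidal hHaag
    act_prod_obj := act_prod_obj
    act_prod_map := fun g {n U V} f {X Y} T =>
      heq_of_opUniv_eq (act_prod_obj g f X) (act_prod_obj g f Y) (by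
        refine Eq.trans ?_ (opUniv_factorization_map hHaag (α.mapOp g f)
          fun i => u.translateHom g (T i)).symm
        refine (congrArg (u.ad g) (opUniv_factorization_map hHaag f T)).trans ?_
        rw [map_list_prod_ofFn]
        rfl)
    act_one_obj := act_one_obj
    act_one_map := fun U {X Y} T => heq_of_opUniv_eq (act_one_obj U X) (act_one_obj U Y) (by
      refine (opUniv_factorization_map hHaag _ _).trans ?_
      simp only [List.ofFn_succ, List.ofFn_zero, List.prod_singleton]
      exact DFunLike.congr_fun u.ad_one (opUniv T))
    act_mul_obj := act_mul_obj
    act_mul_map := fun g' g U {X Y} T =>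
      heq_of_opUniv_eq (act_mul_obj g' g U X) (act_mul_obj g' g U Y) (by
        refine (opUniv_factorization_map hHaag _ _).trans ?_
        simp only [List.ofFn_succ, List.ofFn_zero, List.prod_singleton]
        exact DFunLike.congr_fun (u.ad_mul g' g) (opUniv T)) }

theorem isStandard_equivariantPFA (hsep : P.HasSeparation) :
    u.IsStandard (u.equivariantPFA hHaag hsep) where
  unit _ := rfl
  tensorObj _ _ _ := rfl
  tensorHom _ _ _ _ _ _ _ := rfl
  prod_obj _ _ := rfl
  prod_map _ _ _ _ := rfl
  act_obj _ _ _ := rfl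
  act_map _ _ _ _ _ := rfl

end Implementation

/-! ### Local constancy -/

namespace Sector

variable {U V : C}

/-- The conjugate of a sector by a charge transporter. -/
def transport (ρ : Sector π₀ V) (w : unitary π₀.univ) (hw : ρ.Transports U w) :
    Sector π₀ U where
  hom := (Unitary.conjStarAlgAut ℂ π₀.univ w).toStarAlgHom.comp ρ.hom
  localizable W := by
    obtain ⟨r, hr⟩ := ρ.exists_transports W
    -- Undo `w`, then apply the transporter `r` of the original sector.
    refine ⟨r * star ⟨(w : π₀.univ), Unitary.map_mem π₀.univ.subtype w.2⟩, fun {W' X} f' k h a => ?_⟩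
    have h2 : star ((w : π₀.univ) : H →L[ℂ] H) * (w : π₀.univ) = 1 :=
      congrArg Subtype.val (Unitary.coe_star_mul_self w)
    have h3 := hr h (a := π₀.incl W' a) a.2
    change (r : H →L[ℂ] H) * star ((w : π₀.univ) : H →L[ℂ] H) * ((w : π₀.univ) *
      (ρ.hom (π₀.incl W' a) : H →L[ℂ] H) * star ((w : π₀.univ) : H →L[ℂ] H)) =
      (π₀.incl W' a : H →L[ℂ] H) * (r * star ((w : π₀.univ) : H →L[ℂ] H))
    rw [← mul_assoc _ (r : H →L[ℂ] H), ← h3]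
    calc (r : H →L[ℂ] H) * star ((w : π₀.univ) : H →L[ℂ] H) * ((w : π₀.univ) *
          (ρ.hom (π₀.incl W' a) : H →L[ℂ] H) * star ((w : π₀.univ) : H →L[ℂ] H))
        = r * (star ((w : π₀.univ) : H →L[ℂ] H) * (w : π₀.univ)) *
          (ρ.hom (π₀.incl W' a) : H →L[ℂ] H) * star ((w : π₀.univ) : H →L[ℂ] H) := by
          simp only [mul_assoc]
      _ = _ := by rw [h2, mul_one]
  localized {U' X} f' k h a := by
    have h1 : (w : π₀.univ) * star (w : π₀.univ) = 1 := Unitary.coe_mul_star_self w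
    have h2 : w * ρ.hom (π₀.incl U' a) = π₀.incl U' a * w := Subtype.ext (hw h a.2)
    change w * ρ.hom (π₀.incl U' a) * star (w : π₀.univ) = _
    rw [h2, mul_assoc, h1, mul_one]

theorem coe_hom_transport (ρ : Sector π₀ V) (w : unitary π₀.univ)
    (hw : ρ.Transports U w) (a : π₀.univ) :
    (ρ.transport w hw).hom a = w * ρ.hom a * star (w : π₀.univ) := rfl

/-- An intertwiner between sectors localized in a region is itself localized there. -/
theorem mem_vN_of_intertwines (hHaag : π₀.HaagDuality) {ρ σ : Sector π₀ U} {T : H →L[ℂ] H}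
    (hT : ∀ a : π₀.univ, T * (ρ.hom a : H →L[ℂ] H) = (σ.hom a : H →L[ℂ] H) * T) :
    T ∈ π₀.vN U := by
  refine hHaag.mem_vN fun {U' X} f' k h b hb => ?_
  have := hT (π₀.incl U' ⟨b, hb⟩)
  rw [ρ.hom_eq_self h (a := π₀.incl U' ⟨b, hb⟩) hb,
    σ.hom_eq_self h (a := π₀.incl U' ⟨b, hb⟩) hb] at this
  exact this.symm

variable [IsFiltered C] (hHaag : π₀.HaagDuality)

/-- Along `f` neither endomorphisms nor operators change, so faithfulness is immediate. Fullness is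
Haag duality: the intertwiner is a priori only in `𝔐(V)`, but both sectors are localized in `U`. -/
theorem factorization_unary_bijective (f : U ⟶ V) (X Y : Sector π₀ U) :
    Function.Bijective fun T : X ⟶ Y =>
      (factorization hHaag (Orthogonality.unary (P := P) f)).map (X := fun _ => X) (Y := fun _ => Y)
        (fun _ => T) := by
  have hX : ∀ Z : Sector π₀ U,
      ((factorization hHaag (Orthogonality.unary (P := P) f)).obj fun _ => Z).hom = Z.hom :=
    fun Z => by rw [hom_factorization_obj]; simp
  have hop : ∀ T : X ⟶ Y, opUniv ((factorization hHaag (Orthogonality.unary (P := P) f)).map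
      (X := fun _ => X) (Y := fun _ => Y) (fun _ => T)) = opUniv T := fun T => by
    rw [opUniv_factorization_map]; simp
  refine ⟨fun T S h => hom_ext_univ ?_, fun T => ?_⟩
  · have := congrArg opUniv h
    simpa only [hop] using this
  · have hT : ∀ a : π₀.univ, op T * (X.hom a : H →L[ℂ] H) = (Y.hom a : H →L[ℂ] H) * op T :=
      fun a => by
        have := op_intertwines T a
        rwa [hX, hX] at this
    exact ⟨mkHom (op T) (mem_vN_of_intertwines hHaag hT) hT, hom_ext_univ ((hop _).trans rfl)⟩

theorem locallyConstant_pfa (hsep : P.HasSeparation) :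
    (pfa (π₀ := π₀) hHaag hsep).LocallyConstant := by
  refine fun {U V} f => ⟨factorization_unary_bijective hHaag f, fun Z => ?_⟩
  obtain ⟨w, hw, hw', ht⟩ := Z.exists_transports_univ hHaag U
  let X := Z.transport ⟨w, Unitary.mem_iff.2 ⟨hw, hw'⟩⟩ ht
  have hX : ∀ a, ((factorization hHaag (Orthogonality.unary (P := P) f)).obj fun _ => X).hom a =
      w * Z.hom a * star w := fun a => by
    rw [hom_factorization_obj]
    simp [X, coe_hom_transport]
  -- The unitary `w*` returns from `w Z w*` to `Z`; it is a morphism over `V` because `V` receives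
  -- both `V` and `U`.
  refine ⟨X, mkHom (star w : π₀.univ) (star_mem (ht.mem_vN hHaag (𝟙 V) f)) fun a => ?_,
    hom_ext_univ ?_, hom_ext_univ ?_⟩
  · refine congrArg Subtype.val (?_ : star w * _ = Z.hom a * star w)
    refine (congrArg (star w * ·) (hX a)).trans ?_
    simp only [← mul_assoc, hw, one_mul]
  · refine Eq.trans ?_ hw'
    change star (star w) * star w = _
    rw [star_star]
  · refine Eq.trans ?_ hw
    change star w * star (star w) = _
    rw [star_star]

end Sector

end Hilbert

end

end Superselection

/-! ### Restriction to full subcategories -/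

namespace Superselection

noncomputable section

open CStarCategory

namespace FullSubcat

variable {𝒟 : Type u₁} {Q : 𝒟 → Prop}

@[ext]
theorem ext {X Y : FullSubcat Q} (h : X.obj = Y.obj) : X = Y := by
  cases X; cases Y; cases h; rfl

end FullSubcat

/-- The restriction of a strict monoidal structure to a full subcategory. -/
def StrictMonoidal.restrict {𝒟 : Type u₁} [CStarCategory.{v₁} 𝒟] (M : StrictMonoidal 𝒟)
    {Q : 𝒟 → Prop} (hunit : Q M.unit) (htensor : ∀ X Y, Q X → Q Y → Q (M.tensorObj X Y)) :
    StrictMonoidal (FullSubcat Q) where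
  unit := ⟨M.unit, hunit⟩
  tensorObj X Y := ⟨M.tensorObj X.obj Y.obj, htensor _ _ X.property Y.property⟩
  tensorHom {X X' Y Y'} S T :=
    M.tensorHom (X := X.obj) (X' := X'.obj) (Y := Y.obj) (Y' := Y'.obj) S T
  tensor_id X Y := M.tensor_id X.obj Y.obj
  tensor_comp {X X' X'' Y Y' Y''} := M.tensor_comp (X := X.obj) (X' := X'.obj) (X'' := X''.obj)
    (Y := Y.obj) (Y' := Y'.obj) (Y'' := Y''.obj)
  add_tensor {X X' Y Y'} := M.add_tensor (X := X.obj) (X' := X'.obj) (Y := Y.obj) (Y' := Y'.obj)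
  tensor_add {X X' Y Y'} := M.tensor_add (X := X.obj) (X' := X'.obj) (Y := Y.obj) (Y' := Y'.obj)
  smul_tensor {X X' Y Y'} := M.smul_tensor (X := X.obj) (X' := X'.obj) (Y := Y.obj) (Y' := Y'.obj)
  tensor_smul {X X' Y Y'} := M.tensor_smul (X := X.obj) (X' := X'.obj) (Y := Y.obj) (Y' := Y'.obj)
  tensor_adj {X X' Y Y'} := M.tensor_adj (X := X.obj) (X' := X'.obj) (Y := Y.obj) (Y' := Y'.obj)
  assoc_obj X Y Z := FullSubcat.ext (M.assoc_obj X.obj Y.obj Z.obj)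
  assoc_hom {X X' Y Y' Z Z'} := M.assoc_hom (X := X.obj) (X' := X'.obj) (Y := Y.obj) (Y' := Y'.obj)
    (Z := Z.obj) (Z' := Z'.obj)
  unit_tensor_obj X := FullSubcat.ext (M.unit_tensor_obj X.obj)
  unit_tensor_hom {X X'} := M.unit_tensor_hom (X := X.obj) (X' := X'.obj)
  tensor_unit_obj X := FullSubcat.ext (M.tensor_unit_obj X.obj)
  tensor_unit_hom {X X'} := M.tensor_unit_hom (X := X.obj) (X' := X'.obj)

/-- The restriction of a `*`-functor of several variables to full subcategories. -/
def MultiStarFunctor.restrict {n : ℕ} {𝒟 : Fin n → Type u₁} [∀ i, CStarCategory.{v₁} (𝒟 i)]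
    {ℰ : Type u₂} [CStarCategory.{v₂} ℰ] (F : MultiStarFunctor 𝒟 ℰ) {Q : ∀ i, 𝒟 i → Prop}
    {R : ℰ → Prop} (h : ∀ X : ∀ i, 𝒟 i, (∀ i, Q i (X i)) → R (F.obj X)) :
    MultiStarFunctor (fun i => FullSubcat (Q i)) (FullSubcat R) where
  obj X := ⟨F.obj fun i => (X i).obj, h _ fun i => (X i).property⟩
  map {X Y} T := F.map (X := fun i => (X i).obj) (Y := fun i => (Y i).obj) T
  map_id X := F.map_id fun i => (X i).obj
  map_comp {X Y Z} := F.map_comp (X := fun i => (X i).obj) (Y := fun i => (Y i).obj)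
    (Z := fun i => (Z i).obj)
  map_add {X Y} := F.map_add (X := fun i => (X i).obj) (Y := fun i => (Y i).obj)
  map_smul {X Y} := F.map_smul (X := fun i => (X i).obj) (Y := fun i => (Y i).obj)
  map_adj {X Y} := F.map_adj (X := fun i => (X i).obj) (Y := fun i => (Y i).obj)

/-- The restriction of a `*`-functor to full subcategories. -/
def StarFunctor.restrict {𝒟 : Type u₁} [CStarCategory.{v₁} 𝒟] {ℰ : Type u₂}
    [CStarCategory.{v₂} ℰ] (F : StarFunctor 𝒟 ℰ) {Q : 𝒟 → Prop} {R : ℰ → Prop}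
    (h : ∀ X, Q X → R (F.obj X)) : StarFunctor (FullSubcat Q) (FullSubcat R) where
  obj X := ⟨F.obj X.obj, h _ X.property⟩
  map {X Y} T := F.map (X := X.obj) (Y := Y.obj) T
  map_id X := F.map_id X.obj
  map_comp {X Y Z} := F.map_comp (X := X.obj) (Y := Y.obj) (Z := Z.obj)
  map_add {X Y} := F.map_add (X := X.obj) (Y := Y.obj)
  map_smul {X Y} := F.map_smul (X := X.obj) (Y := Y.obj)
  map_adj {X Y} := F.map_adj (X := X.obj) (Y := Y.obj)

namespace EquivariantPFA

variable {C : Type u} [Category.{v} C] {P : Orthogonality C} {G : Type w} [Group G]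
  {α : P.GroupAction G} {𝒟 : C → Type u₁} [∀ U, CStarCategory.{v₁} (𝒟 U)]
  (𝓕 : EquivariantPFA α 𝒟) {Q : ∀ U, 𝒟 U → Prop}

/-- The restriction of an equivariant prefactorization algebra to full subcategories that are
closed under all operations. -/
def restrict (hunit : ∀ U, Q U (𝓕.mon U).unit)
    (htensor : ∀ U X Y, Q U X → Q U Y → Q U ((𝓕.mon U).tensorObj X Y))
    (hprod : ∀ {n : ℕ} {U : Fin n → C} {V : C} (f : P.Op U V) (X : ∀ i, 𝒟 (U i)),
      (∀ i, Q (U i) (X i)) → Q V ((𝓕.prod f).obj X))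
    (hact : ∀ g U X, Q U X → Q (α.obj g U) ((𝓕.act g U).obj X)) :
    EquivariantPFA α (fun U => FullSubcat (Q U)) where
  mon U := (𝓕.mon U).restrict (hunit U) (htensor U)
  prod f := (𝓕.prod f).restrict (hprod f)
  prod_strictMonoidal f :=
    { unit := FullSubcat.ext (𝓕.prod_strictMonoidal f).unit
      tensorObj := fun _ _ => FullSubcat.ext ((𝓕.prod_strictMonoidal f).tensorObj _ _)
      tensorHom := fun {X X' Y Y'} => (𝓕.prod_strictMonoidal f).tensorHom
        (X := fun i => (X i).obj) (X' := fun i => (X' i).obj)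
        (Y := fun i => (Y i).obj) (Y' := fun i => (Y' i).obj) }
  id_obj V _ := FullSubcat.ext (𝓕.id_obj V _)
  id_map V {X Y} := 𝓕.id_map V (X := fun i => (X i).obj) (Y := fun i => (Y i).obj)
  comp_obj {_ _ _} f {_ _} g X := FullSubcat.ext (𝓕.comp_obj f g fun i l => (X i l).obj)
  comp_map {_ _ _} f {_ _} g {X Y} := 𝓕.comp_map f g (X := fun i l => (X i l).obj)
    (Y := fun i l => (Y i l).obj)
  perm_obj {_ _ _} f σ _ := FullSubcat.ext (𝓕.perm_obj f σ _)
  perm_map {_ _ _} f σ {X Y} := 𝓕.perm_map f σ (X := fun i => (X i).obj) (Y := fun i => (Y i).obj)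
  act g U := (𝓕.act g U).restrict (hact g U)
  act_strictMonoidal g U :=
    { unit := FullSubcat.ext (𝓕.act_strictMonoidal g U).unit
      tensorObj := fun _ _ => FullSubcat.ext ((𝓕.act_strictMonoidal g U).tensorObj _ _)
      tensorHom := fun {X X' Y Y'} => (𝓕.act_strictMonoidal g U).tensorHom
        (X := X.obj) (X' := X'.obj) (Y := Y.obj) (Y' := Y'.obj) }
  act_prod_obj g {_ _ _} f _ := FullSubcat.ext (𝓕.act_prod_obj g f _)
  act_prod_map g {_ _ _} f {X Y} := 𝓕.act_prod_map g f (X := fun i => (X i).obj)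
    (Y := fun i => (Y i).obj)
  act_one_obj U X := FullSubcat.ext (𝓕.act_one_obj U X.obj)
  act_one_map U {X Y} := 𝓕.act_one_map U (X := X.obj) (Y := Y.obj)
  act_mul_obj g' g U X := FullSubcat.ext (𝓕.act_mul_obj g' g U X.obj)
  act_mul_map g' g U {X Y} := 𝓕.act_mul_map g' g U (X := X.obj) (Y := Y.obj)

variable (hunit : ∀ U, Q U (𝓕.mon U).unit)
  (htensor : ∀ U X Y, Q U X → Q U Y → Q U ((𝓕.mon U).tensorObj X Y))
  (hprod : ∀ {n : ℕ} {U : Fin n → C} {V : C} (f : P.Op U V) (X : ∀ i, 𝒟 (U i)),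
    (∀ i, Q (U i) (X i)) → Q V ((𝓕.prod f).obj X))
  (hact : ∀ g U X, Q U X → Q (α.obj g U) ((𝓕.act g U).obj X))

theorem isRestriction_restrict : 𝓕.IsRestriction (𝓕.restrict hunit htensor hprod hact) where
  unit _ := rfl
  tensorObj _ _ _ := rfl
  tensorHom _ _ _ _ _ _ _ := HEq.rfl
  prod_obj _ _ := rfl
  prod_map _ _ _ _ := HEq.rfl
  act_obj _ _ _ := rfl
  act_map _ _ _ _ _ := HEq.rfl

/-- Full faithfulness is inherited. For essential surjectivity the preimage must again satisfy `Q`,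
which is what `hiso` supplies. -/
theorem LocallyConstant.restrict (h : 𝓕.LocallyConstant)
    (hiso : ∀ {U V : C} (f : U ⟶ V) (X : 𝒟 U) (Z : 𝒟 V)
      (T : (𝓕.prod (Orthogonality.unary (P := P) f)).obj (fun _ => X) ⟶ Z),
      IsUnitaryHom T → Q V Z → Q U X) :
    (𝓕.restrict hunit htensor hprod hact).LocallyConstant := by
  refine fun {U V} f => ⟨fun X Y => (h f).1 X.obj Y.obj, fun Z => ?_⟩
  obtain ⟨X, T, hT⟩ := (h f).2 Z.obj
  exact ⟨⟨X, hiso f X Z.obj T hT Z.property⟩, T, hT⟩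

end EquivariantPFA

end

end Superselection

/-! ### Covariant sectors -/

namespace Superselection

noncomputable section

open CStarCategory

section Hilbert

variable {C : Type u} [Category.{v} C] {P : Orthogonality C}
  {H : Type w'} [NormedAddCommGroup H] [InnerProductSpace ℂ H] [CompleteSpace H]
  {A : AQFT.{v, u, w} P} {π₀ : A.Representation H}

open AQFT.Representation

/-- No condition on `|c|` is needed: `b⁻¹a` is already unitary. -/
theorem PU_mk_eq_iff {a b : unitary (H →L[ℂ] H)} :
    (QuotientGroup.mk a : PU H) = QuotientGroup.mk b ↔
      ∃ c : ℂ, (a : H →L[ℂ] H) = c • (b : H →L[ℂ] H) := by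
  rw [eq_comm, QuotientGroup.eq]
  constructor
  · rintro ⟨c, hc⟩
    refine ⟨c, ?_⟩
    have := congrArg ((b : H →L[ℂ] H) * ·) hc
    rw [← Submonoid.coe_mul, mul_inv_cancel_left] at this
    simpa using this
  · rintro ⟨c, hc⟩
    refine ⟨c, ?_⟩
    rw [Submonoid.coe_mul, hc, mul_smul_comm, ← Submonoid.coe_mul, inv_mul_cancel,
      Submonoid.coe_one]

/-- The chosen representatives are multiplicative only up to a scalar, which disappears again in `PU
H`. -/
theorem PU_out_mul (x y : PU H) : ∃ c : ℂ,
    ((x * y).out : H →L[ℂ] H) = c • ((x.out : H →L[ℂ] H) * (y.out : H →L[ℂ] H)) := by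
  have : (QuotientGroup.mk (x * y).out : PU H) = QuotientGroup.mk (x.out * y.out) := by
    rw [QuotientGroup.mk_mul, QuotientGroup.out_eq', QuotientGroup.out_eq', QuotientGroup.out_eq']
  exact PU_mk_eq_iff.1 this

theorem Ad_eq_out (x : PU H) (T : H →L[ℂ] H) :
    Ad H x T = (x.out : H →L[ℂ] H) * T * star (x.out : H →L[ℂ] H) := by
  conv_lhs => rw [← QuotientGroup.out_eq' x]
  rfl

namespace Implementation

variable {G : Type*} [Group G] {α : P.GroupAction G} {Ψ : A.Equivariance α}
  {u : Implementation Ψ π₀}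

/-- Covariance depends on the endomorphism only, not on the localization region. -/
theorem IsCovariant.congr {U V : C} {ρ : Sector π₀ U} {σ : Sector π₀ V} (h : ρ.hom = σ.hom)
    (hρ : u.IsCovariant ρ) : u.IsCovariant σ := by
  obtain ⟨uρ, hu⟩ := hρ
  exact ⟨uρ, fun g a => by rw [← h, hu]⟩

variable (u) in
theorem isCovariant_vacuum (U : C) : u.IsCovariant (Sector.vacuum π₀ U) := ⟨u.u, fun _ _ => rfl⟩

theorem IsCovariant.translate {U : C} {ρ : Sector π₀ U} (hρ : u.IsCovariant ρ) (g : G) :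
    u.IsCovariant (u.translate g ρ) := by
  obtain ⟨uρ, hu⟩ := hρ
  -- The implementing representation is `h ↦ u_g u^ρ_{g⁻¹hg} u_g⁻¹`.
  refine ⟨(MulAut.conj (u.u g)).toMonoidHom.comp (uρ.comp (MulAut.conj g⁻¹).toMonoidHom),
    fun h a => ?_⟩
  have h1 : u.ad g⁻¹ (u.ad h a) = u.ad (g⁻¹ * h * g) (u.ad g⁻¹ a) := by
    rw [ad_mul, ad_mul]
    change _ = u.ad g⁻¹ (u.ad h (u.ad g (u.ad g⁻¹ a)))
    rw [ad_ad_inv]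
  change Ad H (u.u g) (ρ.hom (u.ad g⁻¹ (u.ad h a)) : H →L[ℂ] H) =
    Ad H (u.u g * uρ (g⁻¹ * h * g⁻¹⁻¹) * (u.u g)⁻¹) (Ad H (u.u g) (ρ.hom (u.ad g⁻¹ a) : H →L[ℂ] H))
  rw [← StarAlgEquiv.mul_apply, ← map_mul, inv_mul_cancel_right, inv_inv, map_mul,
    StarAlgEquiv.mul_apply, h1, hu]

/-- Covariance is invariant under unitary equivalence. -/
theorem IsCovariant.of_isUnitaryHom {U : C} {ρ σ : Sector π₀ U} {T : ρ ⟶ σ} (hT : IsUnitaryHom T)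
    (hσ : u.IsCovariant σ) : u.IsCovariant ρ := by
  obtain ⟨uσ, hu⟩ := hσ
  have h1 : star (Sector.op T) * Sector.op T = 1 := congrArg Sector.op hT.1
  have h2 : Sector.op T * star (Sector.op T) = 1 := congrArg Sector.op hT.2
  let x : PU H := QuotientGroup.mk ⟨Sector.op T, Unitary.mem_iff.2 ⟨h1, h2⟩⟩
  have hx : ∀ a, Ad H x (ρ.hom a : H →L[ℂ] H) = σ.hom a := fun a => by
    change Sector.op T * (ρ.hom a : H →L[ℂ] H) * star (Sector.op T) = _
    rw [Sector.op_intertwines, mul_assoc, h2, mul_one]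
  refine ⟨(MulAut.conj x⁻¹).toMonoidHom.comp uσ, fun g a => ?_⟩
  have key : Ad H x (ρ.hom (u.ad g a) : H →L[ℂ] H) =
      Ad H x (Ad H (x⁻¹ * uσ g * x⁻¹⁻¹) (ρ.hom a : H →L[ℂ] H)) := by
    rw [← StarAlgEquiv.mul_apply, ← map_mul, inv_inv, mul_assoc x⁻¹, mul_inv_cancel_left, map_mul,
      StarAlgEquiv.mul_apply, hx, hx, hu]
  exact (Ad H x).injective key

variable [IsFiltered C] (hHaag : π₀.HaagDuality)

/-- The cocycle comparing two implementations of the symmetry lies in the universal algebra. -/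
theorem cocycle_mem_univ (hHaag : π₀.HaagDuality) {U : C} {σ : Sector π₀ U} {g : G} {x : PU H}
    (hx : ∀ a : π₀.univ, (σ.hom (u.ad g a) : H →L[ℂ] H) = Ad H x (σ.hom a : H →L[ℂ] H)) :
    (x.out : H →L[ℂ] H) * star ((u.u g).out : H →L[ℂ] H) ∈ π₀.univ := by
  -- With representatives chosen, `x u_g*` intertwines `g ▷ σ` with `σ`. Both are localized in any
  -- region receiving `α_g(U)` and `U`, so Haag duality applies there.
  refine π₀.vN_le_univ (IsFiltered.max (α.obj g U) U) (Sector.mem_vN_of_intertwines hHaag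
    (ρ := Sector.extend (IsFiltered.leftToMax _ _) (u.translate g σ))
    (σ := Sector.extend (IsFiltered.rightToMax _ _) σ) fun a => ?_)
  have h1 : (σ.hom a : H →L[ℂ] H) = (x.out : H →L[ℂ] H) * (σ.hom (u.ad g⁻¹ a) : H →L[ℂ] H) *
      star (x.out : H →L[ℂ] H) := by
    rw [← Ad_eq_out, ← hx, ad_ad_inv]
  have h2 : star (x.out : H →L[ℂ] H) * x.out = 1 := Unitary.coe_star_mul_self _
  have h3 : star ((u.u g).out : H →L[ℂ] H) * (u.u g).out = 1 := Unitary.coe_star_mul_self _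
  change _ * Ad H (u.u g) (σ.hom (u.ad g⁻¹ a) : H →L[ℂ] H) = (σ.hom a : H →L[ℂ] H) * _
  rw [Ad_eq_out, h1]
  calc _ = (x.out : H →L[ℂ] H) * (star ((u.u g).out : H →L[ℂ] H) * (u.u g).out) *
        (σ.hom (u.ad g⁻¹ a) : H →L[ℂ] H) * star ((u.u g).out : H →L[ℂ] H) := by
        simp only [mul_assoc]
    _ = (x.out : H →L[ℂ] H) * (σ.hom (u.ad g⁻¹ a) : H →L[ℂ] H) *
        (star (x.out : H →L[ℂ] H) * x.out) * star ((u.u g).out : H →L[ℂ] H) := by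
        rw [h2, h3, mul_one, mul_one]
    _ = _ := by simp only [mul_assoc]

/-- The representation for `ρσ` is `ρ(z_g) u^ρ_g` with `z_g = u^σ_g u_g*`. Since `σ Ad_{u_g} =
Ad_{z_g} Ad_{u_g} σ`, applying `ρ` and its covariance gives the implementation property. -/
theorem IsCovariant.comp {U : C} {ρ σ : Sector π₀ U} (hρ : u.IsCovariant ρ)
    (hσ : u.IsCovariant σ) : u.IsCovariant (Sector.comp hHaag ρ σ) := by
  obtain ⟨uρ, hu⟩ := hρ
  obtain ⟨uσ, hv⟩ := hσ
  let z : G → π₀.univ := fun g => ⟨_, cocycle_mem_univ hHaag (hv g)⟩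
  have hz1 : ∀ g, star (z g) * z g = 1 := fun g => Subtype.ext (by
    change star (((uσ g).out * star (u.u g).out : unitary (H →L[ℂ] H)) : H →L[ℂ] H) *
      ((uσ g).out * star (u.u g).out : unitary (H →L[ℂ] H)) = 1
    exact Unitary.coe_star_mul_self _)
  have hz2 : ∀ g, z g * star (z g) = 1 := fun g => Subtype.ext (by
    change (((uσ g).out * star (u.u g).out : unitary (H →L[ℂ] H)) : H →L[ℂ] H) *
      star ((uσ g).out * star (u.u g).out : unitary (H →L[ℂ] H)) = 1
    exact Unitary.coe_mul_star_self _)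
  let ρz : G → unitary (H →L[ℂ] H) := fun g => ⟨ρ.hom (z g), Unitary.map_mem π₀.univ.subtype
    (Unitary.map_mem ρ.hom (Unitary.mem_iff.2 ⟨hz1 g, hz2 g⟩))⟩
  -- Up to phase, `z` is a 1-cocycle for the action `Ad_u`.
  have hzmul : ∀ g h, ∃ c : ℂ, z (g * h) = c • (z g * u.ad g (z h)) := by
    intro g h
    obtain ⟨c, hc⟩ := PU_out_mul (uσ g) (uσ h)
    obtain ⟨d, hd⟩ := PU_out_mul (u.u g) (u.u h)
    have ht : star ((u.u g).out : H →L[ℂ] H) * (u.u g).out = 1 := Unitary.coe_star_mul_self _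
    refine ⟨c * star d, Subtype.ext ?_⟩
    change ((uσ (g * h)).out : H →L[ℂ] H) * star ((u.u (g * h)).out : H →L[ℂ] H) =
      (c * star d) • (((uσ g).out : H →L[ℂ] H) * star ((u.u g).out : H →L[ℂ] H) *
        Ad H (u.u g) (((uσ h).out : H →L[ℂ] H) * star ((u.u h).out : H →L[ℂ] H)))
    rw [Ad_eq_out, map_mul, map_mul, hc, hd, star_smul, star_mul, smul_mul_smul_comm]
    congr 1
    calc _ = ((uσ g).out : H →L[ℂ] H) * 1 * ((uσ h).out : H →L[ℂ] H) *
          star ((u.u h).out : H →L[ℂ] H) * star ((u.u g).out : H →L[ℂ] H) := by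
          simp only [mul_assoc, one_mul]
      _ = _ := by rw [← ht]; simp only [mul_assoc]
  refine ⟨MonoidHom.mk' (fun g => QuotientGroup.mk (ρz g) * uρ g) fun g h => ?_, fun g a => ?_⟩
  · obtain ⟨c, hc⟩ := hzmul g h
    -- Applying `ρ` turns the cocycle identity for `Ad_{u_g}` into one for `Ad_{u^ρ_g}`; this is
    -- exactly multiplicativity of `ρ(z_g) u^ρ_g` in `PU H`.
    have h1 : (QuotientGroup.mk (ρz (g * h)) : PU H) =
        QuotientGroup.mk (ρz g * ((uρ g).out * ρz h * star (uρ g).out)) := by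
      refine PU_mk_eq_iff.2 ⟨c, ?_⟩
      have := congrArg (fun b => (ρ.hom b : H →L[ℂ] H)) hc
      simp only [map_smul, map_mul] at this
      refine this.trans ?_
      change c • ((ρ.hom (z g) : H →L[ℂ] H) * (ρ.hom (u.ad g (z h)) : H →L[ℂ] H)) = _
      rw [hu, Ad_eq_out]
      rfl
    rw [h1, Unitary.star_eq_inv, QuotientGroup.mk_mul, QuotientGroup.mk_mul, QuotientGroup.mk_mul,
      QuotientGroup.mk_inv, QuotientGroup.out_eq', map_mul]
    group
  · have hσ : σ.hom (u.ad g a) = z g * u.ad g (σ.hom a) * star (z g) := Subtype.ext (by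
      have ht : star ((u.u g).out : H →L[ℂ] H) * (u.u g).out = 1 := Unitary.coe_star_mul_self _
      rw [hv, Ad_eq_out]
      change _ = ((uσ g).out : H →L[ℂ] H) * star ((u.u g).out : H →L[ℂ] H) *
        Ad H (u.u g) (σ.hom a : H →L[ℂ] H) *
        star (((uσ g).out : H →L[ℂ] H) * star ((u.u g).out : H →L[ℂ] H))
      rw [Ad_eq_out, star_mul, star_star]
      calc _ = ((uσ g).out : H →L[ℂ] H) * 1 * (σ.hom a : H →L[ℂ] H) * 1 *
            star ((uσ g).out : H →L[ℂ] H) := by simp only [mul_one]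
        _ = _ := by rw [← ht]; simp only [mul_assoc])
    change (ρ.hom (σ.hom (u.ad g a)) : H →L[ℂ] H) =
      Ad H (QuotientGroup.mk (ρz g) * uρ g) (ρ.hom (σ.hom a) : H →L[ℂ] H)
    rw [hσ, map_mul, map_mul, map_mul (Ad H), StarAlgEquiv.mul_apply, ← hu, map_star]
    rfl

theorem isCovariant_prodObj {U : C} {n : ℕ} {X : Fin n → Sector π₀ U}
    (h : ∀ i, u.IsCovariant (X i)) : u.IsCovariant ((Sector.monoidal hHaag U).prodObj X) := by
  induction n with
  | zero => exact u.isCovariant_vacuum U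
  | succ n ih => exact (h 0).comp hHaag (ih fun i => h i.succ)

end Implementation

end Hilbert

end

end Superselection

theorem theorem4p8 {C : Type u} [Category.{v} C] [IsFiltered C] (P : Orthogonality C)
    {G : Type u₁} [Group G] (α : P.GroupAction G)
    (A : AQFT.{v, u, w} P) (Ψ : A.Equivariance α)
    {H : Type w'} [NormedAddCommGroup H] [InnerProductSpace ℂ H] [CompleteSpace H]
    (π₀ : A.Representation H)
    (hcompl : P.HasOrthogonalComplements)
    (hfaithful : π₀.LocallyFaithful)
    (hHaag : π₀.HaagDuality)
    (hsep : P.HasSeparation)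
    (u : Implementation Ψ π₀) :
    ∃ 𝓕 : EquivariantPFA α (fun U => Sector π₀ U),
      u.IsStandard 𝓕 ∧ 𝓕.LocallyConstant ∧
      ∃ 𝓕cov : EquivariantPFA α (fun U => u.CovariantSector U),
        𝓕.IsRestriction 𝓕cov ∧ 𝓕cov.LocallyConstant := by
  have hprod : ∀ {n : ℕ} {U : Fin n → C} {V : C} (f : P.Op U V) (X : ∀ i, Sector π₀ (U i)),
      (∀ i, u.IsCovariant (X i)) → u.IsCovariant (((u.equivariantPFA hHaag hsep).prod f).obj X) :=
    fun f X h => Implementation.isCovariant_prodObj hHaag fun i => (h i).congr rfl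
  have hlc : (u.equivariantPFA hHaag hsep).LocallyConstant :=
    Sector.locallyConstant_pfa hHaag hsep
  have hunit : ∀ U, u.IsCovariant ((u.equivariantPFA hHaag hsep).mon U).unit :=
    u.isCovariant_vacuum
  have htensor : ∀ U X Y, u.IsCovariant X → u.IsCovariant Y →
      u.IsCovariant (((u.equivariantPFA hHaag hsep).mon U).tensorObj X Y) :=
    fun _ _ _ hX hY => hX.comp hHaag hY
  have hact : ∀ g U X, u.IsCovariant X →
      u.IsCovariant (((u.equivariantPFA hHaag hsep).act g U).obj X) := fun g _ _ hX =>
    hX.translate g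
  refine ⟨u.equivariantPFA hHaag hsep, u.isStandard_equivariantPFA hHaag hsep, hlc,
    (u.equivariantPFA hHaag hsep).restrict (Q := fun U ρ => u.IsCovariant ρ) hunit htensor hprod
      hact, EquivariantPFA.isRestriction_restrict _ _ _ _ _, ?_⟩
  refine EquivariantPFA.LocallyConstant.restrict (Q := fun U ρ => u.IsCovariant ρ) _ hunit htensor
    hprod hact hlc fun f X Z T hT hZ => ?_
  -- The unitary makes the image of `X` over the larger region covariant, and that image has the
  -- same endomorphism as `X`.
  refine (Implementation.IsCovariant.of_isUnitaryHom hT hZ).congr ?_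
  refine (Sector.hom_factorization_obj hHaag _ _).trans ?_
  simp
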